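/- Let $K$ be an algebraically closed field of characteristic zero and let $n\ge 2$. Let $A_n=K[x^n,x^{n-1}y,\ldots,xy^{n-1},y^n]$ be the subalgebra of the polynomial algebra $K[x,y]$ generated over $K$ by the monomials $x^{n-i}y^i$, $0\le i\le n$. Let $K[x,y]_1$ denote the $K$-linear span of all monomials $x^ay^b$ with $a+b\equiv 1 \pmod n$. A $K$-algebra automorphism $\varphi$ of $K[x,y]$ is called $n$-graded if $\varphi(x),\varphi(y)\in K[x,y]_1$. It is called elementary if either $\varphi(x)=x$ and $\varphi(y)=cy+f(x)$, or $\varphi(x)=cx+f(y)$ and $\varphi(y)=y$, for some nonzero $c\in K$ and some one-variable polynomial $f$ over $K$. It is called a tame $n$-graded automorphism if it is a product (composition) of finitely many elementary automorphisms each of which is $n$-graded. Then for every $K$-algebra automorphism $\alpha$ of $A_n$ there is an $n$-graded automorphism $\varphi$ of $K[x,y]$, which can moreover be chosen to be a tame $n$-graded automorphism, such that $\varphi(a)=\alpha(a)$ for all $a\in A_n$. -/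

import Mathlib

namespace Veronese

open MvPolynomial

/-- The subalgebra `K[x^n, x^(n-1) y, …, x y^(n-1), y^n]` of `K[x, y]`,
with `x = X 0` and `y = X 1`. -/
noncomputable def veroneseAlgebra (K : Type*) [Field K] (n : ℕ) :
    Subalgebra K (MvPolynomial (Fin 2) K) :=
  Algebra.adjoin K {p | ∃ i : ℕ, i ≤ n ∧ p = X 0 ^ (n - i) * X 1 ^ i}

/-- The component `K[x, y]_i`, for `i` in `ℤ/nℤ`, of the `n`-grading of `K[x, y]`: the linear span
of all monomials whose degree is congruent to `i` modulo `n`. -/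
noncomputable def gradedPart (K : Type*) [Field K] (n : ℕ) (i : ZMod n) :
    Submodule K (MvPolynomial (Fin 2) K) :=
  Submodule.span K {p | ∃ a b : ℕ, ((a + b : ℕ) : ZMod n) = i ∧ p = X 0 ^ a * X 1 ^ b}

/-- An automorphism `φ` of `K[x, y]` is `n`-graded if `φ x` and `φ y` lie in `K[x, y]_1`. -/
def IsNGraded {K : Type*} [Field K] (n : ℕ)
    (φ : MvPolynomial (Fin 2) K ≃ₐ[K] MvPolynomial (Fin 2) K) : Prop :=
  φ (X 0) ∈ gradedPart K n 1 ∧ φ (X 1) ∈ gradedPart K n 1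

/-- An automorphism of `K[x, y]` is elementary if it is `(x, c y + f(x))` or `(c x + f(y), y)`,
with `c` a nonzero scalar and `f` a polynomial in one variable. -/
def IsElementary {K : Type*} [Field K]
    (φ : MvPolynomial (Fin 2) K ≃ₐ[K] MvPolynomial (Fin 2) K) : Prop :=
  (∃ (c : K) (f : Polynomial K), c ≠ 0 ∧
    φ (X 0) = X 0 ∧ φ (X 1) = C c * X 1 + Polynomial.aeval (X 0) f) ∨
  (∃ (c : K) (f : Polynomial K), c ≠ 0 ∧
    φ (X 0) = C c * X 0 + Polynomial.aeval (X 1) f ∧ φ (X 1) = X 1)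

/-- An automorphism of `K[x, y]` is a tame `n`-graded automorphism if it is a product of `n`-graded
elementary automorphisms. -/
def IsTameNGraded {K : Type*} [Field K] (n : ℕ)
    (φ : MvPolynomial (Fin 2) K ≃ₐ[K] MvPolynomial (Fin 2) K) : Prop :=
  ∃ l : List (MvPolynomial (Fin 2) K ≃ₐ[K] MvPolynomial (Fin 2) K),
    (∀ ψ ∈ l, IsElementary ψ ∧ IsNGraded n ψ) ∧ l.prod = φ

end Veronese

/-! The images `u i` of the generators `x^(n-i) y^i` satisfy `u (i+1) * u 0 = u i * u 1`, so unique
factorisation gives `u i = g q^(n-i) p^i`. Modulo `g` every element of the image is constant;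
surjectivity makes `x^n` and `y^n` constant modulo `g`, so `g` is a scalar, and its `n`-th root can
be absorbed into `q` and `p`. Thus the automorphism and its inverse both extend to endomorphisms of
`K[x, y]`. Their composites fix `A_n`, hence are homotheties, so the extension `φ` is bijective.
Conjugating `(ε x, ε y)`, `ε` a primitive `n`-th root of unity, by `φ` also gives a homothety;
linear parts show that it is the same one, so `φ` is `n`-graded.

Tameness is Jung's theorem with the grading carried along. The Jacobian derivation of `q = φ x` is
conjugate to a multiple of `∂/∂y`, so it is locally nilpotent, and so is that of the leading form of
`q` for the Newton polygon weights. Kernels of locally nilpotent derivations are factorially closed,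
which makes this form `c (x^b - μ y^a)^r` with `a = 1` or `b = 1`. If `a = 1`, the substitution `y ↦
y + μ⁻¹ x^b` lowers the degree. It is graded: `x^(b r)` and `y^r` occur in `q`, so `b r ≡ r ≡ 1`,
whence `b ≡ 1` modulo `n`. -/

namespace Veronese

open MvPolynomial

/-! ### Locally nilpotent derivations and their degree function. -/

section Derivation

variable {K R : Type*} [Field K] [CommRing R] [Algebra K R]

/-- A derivation is locally nilpotent if every element is killed by some iterate of it. -/
def IsLocallyNilpotent (D : Derivation K R R) : Prop :=
  ∀ f, ∃ n : ℕ, D^[n] f = 0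

lemma iterate_derivation_zero (D : Derivation K R R) (n : ℕ) : D^[n] 0 = 0 :=
  Function.iterate_fixed (map_zero D) n

lemma iterate_derivation_add (D : Derivation K R R) (n : ℕ) (f g : R) :
    D^[n] (f + g) = D^[n] f + D^[n] g :=
  iterate_map_add D n f g

lemma iterate_derivation_mul_left (D : Derivation K R R) {c : R} (hc : D c = 0) (n : ℕ) (f : R) :
    D^[n] (c * f) = c * D^[n] f := by
  induction n generalizing f with
  | zero => rfl
  | succ n ih => simp [Function.iterate_succ_apply, hc, ih]

lemma iterate_derivation_eq_zero_of_le (D : Derivation K R R) {n m : ℕ} (h : n ≤ m) {f : R}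
    (hf : D^[n] f = 0) : D^[m] f = 0 := by
  obtain ⟨k, rfl⟩ := Nat.exists_eq_add_of_le h
  rw [add_comm, Function.iterate_add_apply, hf, iterate_derivation_zero]

/-- The top term of the iterated Leibniz rule. -/
lemma iterate_derivation_mul (D : Derivation K R R) (N M : ℕ) (f g : R)
    (hf : D^[N + 1] f = 0) (hg : D^[M + 1] g = 0) :
    D^[N + M] (f * g) = ((N + M).choose N : R) * (D^[N] f * D^[M] g) := by
  induction h : N + M generalizing N M f g with
  | zero =>
    obtain ⟨rfl, rfl⟩ : N = 0 ∧ M = 0 := by omega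
    simp
  | succ k ih =>
    rcases N with _ | N
    · rw [Function.iterate_one] at hf
      rw [iterate_derivation_mul_left D hf]
      obtain rfl : M = k + 1 := by omega
      simp
    rcases M with _ | M
    · rw [Function.iterate_one] at hg
      rw [mul_comm f g, iterate_derivation_mul_left D hg]
      obtain rfl : N = k := by omega
      simp [mul_comm]
    have h1 := ih (N + 1) M f (D g) hf hg (by omega)
    have h2 := ih N (M + 1) (D f) g hf hg (by omega)
    rw [Function.iterate_succ_apply, Derivation.leibniz, iterate_derivation_add, smul_eq_mul,
      smul_eq_mul, h1, mul_comm g, h2, Nat.choose_succ_succ,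
      Function.iterate_succ_apply D M, Function.iterate_succ_apply D N]
    push_cast
    ring

lemma iterate_derivation_mul_eq_zero (D : Derivation K R R) {N M : ℕ} {f g : R}
    (hf : D^[N] f = 0) (hg : D^[M] g = 0) : D^[N + M] (f * g) = 0 := by
  rcases N with _ | N
  · simp only [Function.iterate_zero, id] at hf
    rw [hf, zero_mul, iterate_derivation_zero]
  rcases M with _ | M
  · simp only [Function.iterate_zero, id] at hg
    rw [hg, mul_zero, iterate_derivation_zero]
  refine iterate_derivation_eq_zero_of_le D (n := N + 1 + M) (by omega) ?_
  -- With `N + 1` in place of `N`, the top Leibniz term contains `D^[N + 1] f = 0`.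
  have h := iterate_derivation_mul D (N + 1) M f g
    (iterate_derivation_eq_zero_of_le D (by omega) hf) hg
  rw [h, hf, zero_mul, mul_zero]

lemma IsLocallyNilpotent.exists_degree {D : Derivation K R R} (hD : IsLocallyNilpotent D) {f : R}
    (hf : f ≠ 0) : ∃ N : ℕ, D^[N] f ≠ 0 ∧ D^[N + 1] f = 0 := by
  classical
  have h := Nat.find_spec (hD f)
  rcases hN : Nat.find (hD f) with _ | N
  · rw [hN] at h
    exact absurd h hf
  · rw [hN] at h
    exact ⟨N, Nat.find_min (hD f) (by omega), h⟩

variable [IsDomain R] [CharZero R]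

/-- The binomial coefficient is nonzero in characteristic zero, so the degree attached to `D` is
additive on products. -/
lemma iterate_derivation_mul_ne_zero (D : Derivation K R R) {N M : ℕ} {f g : R}
    (hf : D^[N] f ≠ 0) (hf' : D^[N + 1] f = 0) (hg : D^[M] g ≠ 0) (hg' : D^[M + 1] g = 0) :
    D^[N + M] (f * g) ≠ 0 := by
  rw [iterate_derivation_mul D N M f g hf' hg']
  refine mul_ne_zero ?_ (mul_ne_zero hf hg)
  exact_mod_cast (Nat.choose_pos (Nat.le_add_right N M)).ne'

/-- The kernel of a locally nilpotent derivation is factorially closed. -/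
lemma IsLocallyNilpotent.eq_zero_of_dvd {D : Derivation K R R} (hD : IsLocallyNilpotent D)
    {f h : R} (hh : h ≠ 0) (hDh : D h = 0) (hfh : f ∣ h) : D f = 0 := by
  obtain ⟨g, rfl⟩ := hfh
  obtain ⟨N, hN, hN'⟩ := hD.exists_degree (left_ne_zero_of_mul hh)
  obtain ⟨M, hM, hM'⟩ := hD.exists_degree (right_ne_zero_of_mul hh)
  have h := iterate_derivation_mul_ne_zero D hN hN' hM hM'
  -- Degrees add up to that of `h`, which is zero.
  rcases Nat.eq_zero_or_pos (N + M) with h0 | h0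
  · obtain rfl : N = 0 := by omega
    simpa using hN'
  · exact absurd (iterate_derivation_eq_zero_of_le D (n := 1) h0 hDh) h

/-- If `v` divides `D u ≠ 0`, the degree of `v` is less than that of `u`. -/
lemma IsLocallyNilpotent.degree_lt_of_dvd {D : Derivation K R R} (hD : IsLocallyNilpotent D)
    {u v : R} {s t : ℕ} (hs' : D^[s + 1] u = 0) (ht : D^[t] v ≠ 0) (ht' : D^[t + 1] v = 0)
    (hDu : D u ≠ 0) (h : v ∣ D u) : t < s := by
  obtain ⟨w, hw⟩ := h
  have hw0 : w ≠ 0 := by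
    rintro rfl
    exact hDu (by rw [hw, mul_zero])
  obtain ⟨M, hM, hM'⟩ := hD.exists_degree hw0
  have h := iterate_derivation_mul_ne_zero D ht ht' hM hM'
  rw [← hw, ← Function.iterate_succ_apply] at h
  by_contra! hst
  exact h (iterate_derivation_eq_zero_of_le D (by omega) hs')

/-- Each divisibility would make the degree of one element strictly smaller than that of the other.
This is what excludes `a, b ≥ 2` in the leading form. -/
lemma IsLocallyNilpotent.not_dvd_and_dvd {D : Derivation K R R} (hD : IsLocallyNilpotent D)
    {u v : R} (hu : D u ≠ 0) (hv : D v ≠ 0) : ¬ (v ∣ D u ∧ u ∣ D v) := by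
  rintro ⟨h1, h2⟩
  have hu0 : u ≠ 0 := by
    rintro rfl
    exact hu (map_zero D)
  have hv0 : v ≠ 0 := by
    rintro rfl
    exact hv (map_zero D)
  obtain ⟨s, hs, hs'⟩ := hD.exists_degree hu0
  obtain ⟨t, ht, ht'⟩ := hD.exists_degree hv0
  have := hD.degree_lt_of_dvd hs' ht ht' hu h1
  have := hD.degree_lt_of_dvd ht' hs hs' hv h2
  omega

end Derivation

/-! ### Jacobian derivations of the plane. -/

section Jacobian

variable {K : Type*} [Field K]

lemma isLocallyNilpotent_of_forall_X
    (D : Derivation K (MvPolynomial (Fin 2) K) (MvPolynomial (Fin 2) K))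
    (h : ∀ i, ∃ n : ℕ, D^[n] (X i) = 0) : IsLocallyNilpotent D := by
  intro f
  induction f using MvPolynomial.induction_on with
  | C c => exact ⟨1, D.map_algebraMap c⟩
  | add p q hp hq =>
    obtain ⟨n, hn⟩ := hp
    obtain ⟨m, hm⟩ := hq
    refine ⟨n + m, ?_⟩
    rw [iterate_derivation_add, iterate_derivation_eq_zero_of_le D (by omega) hn,
      iterate_derivation_eq_zero_of_le D (by omega) hm, add_zero]
  | mul_X p i hp =>
    obtain ⟨n, hn⟩ := hp
    obtain ⟨m, hm⟩ := h i
    exact ⟨n + m, iterate_derivation_mul_eq_zero D hn hm⟩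

/-- The Jacobian derivation `f ↦ q_x f_y - q_y f_x` of `K[x, y]`. -/
noncomputable def jacobian (q : MvPolynomial (Fin 2) K) :
    Derivation K (MvPolynomial (Fin 2) K) (MvPolynomial (Fin 2) K) :=
  pderiv 0 q • pderiv 1 - pderiv 1 q • pderiv 0

lemma jacobian_apply (q f : MvPolynomial (Fin 2) K) :
    jacobian q f = pderiv 0 q * pderiv 1 f - pderiv 1 q * pderiv 0 f := rfl

lemma jacobian_X_zero (q : MvPolynomial (Fin 2) K) : jacobian q (X 0) = - pderiv 1 q := by
  simp [jacobian_apply]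

lemma jacobian_X_one (q : MvPolynomial (Fin 2) K) : jacobian q (X 1) = pderiv 0 q := by
  simp [jacobian_apply]

lemma jacobian_self (q : MvPolynomial (Fin 2) K) : jacobian q q = 0 := by
  rw [jacobian_apply]; ring

/-- The chain rule. -/
lemma pderiv_algHom (φ : MvPolynomial (Fin 2) K →ₐ[K] MvPolynomial (Fin 2) K) (i : Fin 2)
    (f : MvPolynomial (Fin 2) K) :
    pderiv i (φ f) = φ (pderiv 0 f) * pderiv i (φ (X 0)) + φ (pderiv 1 f) * pderiv i (φ (X 1)) := by
  induction f using MvPolynomial.induction_on with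
  | C c => simp [← algebraMap_eq]
  | add p q hp hq => simp only [map_add, hp, hq]; ring
  | mul_X p j hp =>
    fin_cases j
    · simp [hp]; ring
    · simp [hp]; ring

variable (φ : MvPolynomial (Fin 2) K ≃ₐ[K] MvPolynomial (Fin 2) K)

lemma pderiv_algEquiv (i : Fin 2) (f : MvPolynomial (Fin 2) K) :
    pderiv i (φ f) = φ (pderiv 0 f) * pderiv i (φ (X 0)) + φ (pderiv 1 f) * pderiv i (φ (X 1)) :=
  pderiv_algHom φ.toAlgHom i f

lemma jacobian_algEquiv (f : MvPolynomial (Fin 2) K) :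
    jacobian (φ (X 0)) (φ f) = jacobian (φ (X 0)) (φ (X 1)) * φ (pderiv 1 f) := by
  simp only [jacobian_apply, pderiv_algEquiv φ _ f]
  ring

/-- The Jacobian determinant of an automorphism is a nonzero constant. -/
lemma exists_jacobian_eq_C : ∃ c : K, c ≠ 0 ∧ jacobian (φ (X 0)) (φ (X 1)) = C c := by
  -- Differentiating `φ (φ⁻¹ x_j) = x_j` exhibits an inverse of the Jacobian matrix; its determinant
  -- inverts the Jacobian.
  have h (i j : Fin 2) := pderiv_algEquiv φ i (φ.symm (X j))
  simp only [AlgEquiv.apply_symm_apply] at h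
  have h00 := h 0 0
  have h01 := h 0 1
  have h10 := h 1 0
  have h11 := h 1 1
  rw [pderiv_X_self] at h00 h11
  rw [pderiv_X_of_ne (by decide)] at h01 h10
  have hu : IsUnit (jacobian (φ (X 0)) (φ (X 1))) := by
    rw [jacobian_apply]
    refine IsUnit.of_mul_eq_one (φ (pderiv 0 (φ.symm (X 0))) * φ (pderiv 1 (φ.symm (X 1))) -
      φ (pderiv 1 (φ.symm (X 0))) * φ (pderiv 0 (φ.symm (X 1)))) ?_
    generalize φ (pderiv 0 (φ.symm (X 0))) = A at *
    generalize φ (pderiv 1 (φ.symm (X 0))) = B at *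
    generalize φ (pderiv 0 (φ.symm (X 1))) = E at *
    generalize φ (pderiv 1 (φ.symm (X 1))) = F at *
    generalize pderiv 0 (φ (X 0)) = a at *
    generalize pderiv 1 (φ (X 0)) = b at *
    generalize pderiv 0 (φ (X 1)) = c at *
    generalize pderiv 1 (φ (X 1)) = d at *
    linear_combination (-(E * b + F * d)) * h00 + (A * b + B * d) * h01 - h11
  obtain ⟨c, hc, h⟩ := isUnit_iff_eq_C_of_isReduced.mp hu
  exact ⟨c, hc.ne_zero, h⟩

lemma isLocallyNilpotent_pderiv (i : Fin 2) :
    IsLocallyNilpotent (pderiv i : Derivation K (MvPolynomial (Fin 2) K) _) := by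
  refine isLocallyNilpotent_of_forall_X _ fun j => ⟨2, ?_⟩
  classical
  simp only [Function.iterate_succ, Function.iterate_zero, Function.comp, id, pderiv_X]
  by_cases h : i = j
  · subst h; simp
  · simp [Ne.symm h]

/-- Conjugation by `φ` turns this derivation into a constant multiple of `∂/∂y`. -/
lemma isLocallyNilpotent_jacobian : IsLocallyNilpotent (jacobian (φ (X 0))) := by
  obtain ⟨c, -, hc⟩ := exists_jacobian_eq_C φ
  have h (n : ℕ) (f : MvPolynomial (Fin 2) K) :
      (jacobian (φ (X 0)))^[n] (φ f) = C c ^ n * φ ((pderiv 1)^[n] f) := by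
    induction n with
    | zero => simp
    | succ n ih =>
      have h0 : jacobian (φ (X 0)) (C c ^ n) = 0 := by
        rw [← map_pow]
        exact Derivation.map_algebraMap _ _
      rw [Function.iterate_succ_apply', ih, Derivation.leibniz, h0, jacobian_algEquiv, hc,
        Function.iterate_succ_apply', smul_zero, add_zero, smul_eq_mul]
      ring
  intro f
  obtain ⟨n, hn⟩ := isLocallyNilpotent_pderiv 1 (φ.symm f)
  refine ⟨n, ?_⟩
  have := h n (φ.symm f)
  rwa [hn, map_zero, mul_zero, AlgEquiv.apply_symm_apply] at this

end Jacobian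

/-! ### Leading forms for weighted degrees. -/

section LeadingForm

variable {K : Type*} [Field K]

/-- The weight of an exponent when `x` has weight `a` and `y` has weight `b`. -/
def weight (a b : ℕ) (s : Fin 2 →₀ ℕ) : ℤ := a * s 0 + b * s 1

lemma weight_add (a b : ℕ) (s t : Fin 2 →₀ ℕ) :
    weight a b (s + t) = weight a b s + weight a b t := by
  simp only [weight, Finsupp.add_apply]
  push_cast
  ring

/-- `g` is homogeneous of weight `e`, and `f - g` has only monomials of weight less than `e`. -/
def IsLeading (a b : ℕ) (e : ℤ) (f g : MvPolynomial (Fin 2) K) : Prop :=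
  (∀ s, coeff s g ≠ 0 → weight a b s = e) ∧ ∀ s, coeff s (f - g) ≠ 0 → weight a b s < e

variable {a b : ℕ} {e e' : ℤ} {f f' g g' : MvPolynomial (Fin 2) K}

lemma exists_coeff_ne_zero_of_coeff_mul_ne_zero {s : Fin 2 →₀ ℕ} (h : coeff s (f * g) ≠ 0) :
    ∃ t u, coeff t f ≠ 0 ∧ coeff u g ≠ 0 ∧ s = t + u := by
  classical
  rw [coeff_mul] at h
  obtain ⟨⟨t, u⟩, htu, h⟩ := Finset.exists_ne_zero_of_sum_ne_zero h
  exact ⟨t, u, left_ne_zero_of_mul h, right_ne_zero_of_mul h,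
    (Finset.HasAntidiagonal.mem_antidiagonal.mp htu).symm⟩

lemma coeff_ne_zero_or_of_coeff_add_ne_zero {s : Fin 2 →₀ ℕ} (h : coeff s (f + g) ≠ 0) :
    coeff s f ≠ 0 ∨ coeff s g ≠ 0 := by
  by_contra! h'
  exact h (by rw [coeff_add, h'.1, h'.2, add_zero])

lemma isLeading_of_homogeneous (h : ∀ s, coeff s g ≠ 0 → weight a b s = e) :
    IsLeading a b e g g :=
  ⟨h, fun s hs => absurd (by simp) hs⟩

lemma IsLeading.add (h : IsLeading a b e f g) (h' : IsLeading a b e f' g') :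
    IsLeading a b e (f + f') (g + g') := by
  refine ⟨fun s hs => ?_, fun s hs => ?_⟩
  · rcases coeff_ne_zero_or_of_coeff_add_ne_zero hs with hs | hs
    exacts [h.1 s hs, h'.1 s hs]
  · rw [add_sub_add_comm] at hs
    rcases coeff_ne_zero_or_of_coeff_add_ne_zero hs with hs | hs
    exacts [h.2 s hs, h'.2 s hs]

lemma IsLeading.neg (h : IsLeading a b e f g) : IsLeading a b e (-f) (-g) := by
  refine ⟨fun s hs => h.1 s (by simpa using hs), fun s hs => h.2 s ?_⟩
  rw [← neg_sub', coeff_neg] at hs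
  exact neg_ne_zero.mp hs

lemma IsLeading.sub (h : IsLeading a b e f g) (h' : IsLeading a b e f' g') :
    IsLeading a b e (f - f') (g - g') := by
  rw [sub_eq_add_neg, sub_eq_add_neg]
  exact h.add h'.neg

lemma IsLeading.mul (h : IsLeading a b e f g) (h' : IsLeading a b e' f' g') :
    IsLeading a b (e + e') (f * f') (g * g') := by
  refine ⟨fun s hs => ?_, fun s hs => ?_⟩
  · obtain ⟨t, u, ht, hu, rfl⟩ := exists_coeff_ne_zero_of_coeff_mul_ne_zero hs
    rw [weight_add, h.1 t ht, h'.1 u hu]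
  · have : f * f' - g * g' = ((f - g) * (f' - g') + (f - g) * g') + g * (f' - g') := by ring
    rw [this] at hs
    rcases coeff_ne_zero_or_of_coeff_add_ne_zero hs with hs | hs
    · rcases coeff_ne_zero_or_of_coeff_add_ne_zero hs with hs | hs
      · obtain ⟨t, u, ht, hu, rfl⟩ := exists_coeff_ne_zero_of_coeff_mul_ne_zero hs
        rw [weight_add]
        linarith [h.2 t ht, h'.2 u hu]
      · obtain ⟨t, u, ht, hu, rfl⟩ := exists_coeff_ne_zero_of_coeff_mul_ne_zero hs
        rw [weight_add]
        linarith [h.2 t ht, h'.1 u hu]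
    · obtain ⟨t, u, ht, hu, rfl⟩ := exists_coeff_ne_zero_of_coeff_mul_ne_zero hs
      rw [weight_add]
      linarith [h.1 t ht, h'.2 u hu]

lemma isLeading_C (a b : ℕ) (c : K) : IsLeading a b 0 (C c) (C c) := by
  classical
  refine isLeading_of_homogeneous fun s hs => ?_
  rw [coeff_C] at hs
  obtain rfl : 0 = s := by
    by_contra h
    exact hs (if_neg h)
  simp [weight]

lemma isLeading_X (a b : ℕ) (i : Fin 2) :
    IsLeading a b (weight a b (Finsupp.single i 1)) (X i : MvPolynomial (Fin 2) K) (X i) := by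
  classical
  refine isLeading_of_homogeneous fun s hs => ?_
  rw [coeff_X] at hs
  obtain rfl : Finsupp.single i 1 = s := by
    by_contra h
    exact hs (if_neg h)
  rfl

lemma IsLeading.pow (h : IsLeading a b e f g) (n : ℕ) : IsLeading a b (n * e) (f ^ n) (g ^ n) := by
  induction n with
  | zero => simpa using isLeading_C a b (1 : K)
  | succ n ih =>
    rw [pow_succ, pow_succ]
    convert ih.mul h using 1
    push_cast
    ring

lemma IsLeading.pderiv (h : IsLeading a b e f g) (i : Fin 2) :
    IsLeading a b (e - weight a b (Finsupp.single i 1)) (pderiv i f) (pderiv i g) := by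
  have key (p : MvPolynomial (Fin 2) K) (s) (hs : coeff s (MvPolynomial.pderiv i p) ≠ 0) :
      coeff (s + Finsupp.single i 1) p ≠ 0 := by
    rw [coeff_pderiv] at hs
    exact left_ne_zero_of_mul hs
  refine ⟨fun s hs => ?_, fun s hs => ?_⟩
  · rw [← h.1 _ (key g s hs), weight_add]
    ring
  · rw [← map_sub] at hs
    have := h.2 _ (key _ s hs)
    rw [weight_add] at this
    linarith

/-- `IsLeading` allows a zero form, so it survives products and derivatives even when top terms
cancel; this lemma then transfers vanishing from a polynomial to its form. -/
lemma IsLeading.eq_zero (h : IsLeading a b e 0 g) : g = 0 := by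
  ext s
  by_contra hs
  rw [coeff_zero] at hs
  have := h.1 s hs
  have := h.2 s (by simpa using hs)
  omega

lemma IsLeading.coeff_eq (h : IsLeading a b e f g) {s : Fin 2 →₀ ℕ} (hs : weight a b s = e) :
    coeff s f = coeff s g := by
  by_contra hne
  exact (h.2 s (by rwa [coeff_sub, sub_ne_zero])).ne hs

lemma IsLeading.weight_le (h : IsLeading a b e f g) {s : Fin 2 →₀ ℕ} (hs : coeff s f ≠ 0) :
    weight a b s ≤ e := by
  by_contra! hlt
  by_cases hg : coeff s g = 0
  · have := h.2 s (by rwa [coeff_sub, hg, sub_zero])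
    omega
  · exact hlt.ne' (h.1 s hg)

lemma exists_isLeading (a b : ℕ) (hf : f ≠ 0) : ∃ e g, g ≠ 0 ∧ IsLeading a b e f g := by
  classical
  obtain ⟨s₀, hs₀, hmax⟩ := Finset.exists_max_image f.support (weight a b) (by simpa using hf)
  let g := ∑ s ∈ f.support with weight a b s = weight a b s₀, monomial s (coeff s f)
  have hg (s) : coeff s g = if weight a b s = weight a b s₀ then coeff s f else 0 := by
    simp only [g, coeff_sum, coeff_monomial, Finset.sum_ite_eq', Finset.mem_filter, mem_support_iff]
    split_ifs <;> simp_all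
  refine ⟨weight a b s₀, g, fun h0 => ?_, fun s hs => ?_, fun s hs => ?_⟩
  · have := hg s₀
    rw [h0, if_pos rfl, coeff_zero] at this
    exact mem_support_iff.mp hs₀ this.symm
  · by_contra h
    exact hs (by rw [hg, if_neg h])
  · rw [coeff_sub, hg] at hs
    split_ifs at hs with h
    · simp at hs
    · rw [sub_zero] at hs
      exact lt_of_le_of_ne (hmax s (mem_support_iff.mpr hs)) h

lemma IsLeading.jacobian (h : IsLeading a b e f g) (h' : IsLeading a b e' f' g') :
    IsLeading a b (e' + (e - a - b)) (jacobian f f') (jacobian g g') := by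
  have hw0 : weight a b (Finsupp.single 0 1) = a := by simp [weight]
  have hw1 : weight a b (Finsupp.single 1 1) = b := by simp [weight]
  rw [jacobian_apply, jacobian_apply]
  refine IsLeading.sub ?_ ?_
  · convert (h.pderiv 0).mul (h'.pderiv 1) using 1
    rw [hw0, hw1]; ring
  · convert (h.pderiv 1).mul (h'.pderiv 0) using 1
    rw [hw0, hw1]; ring

/-- Local nilpotency of the Jacobian derivation passes to leading forms. -/
lemma IsLeading.isLocallyNilpotent_jacobian (h : IsLeading a b e f g)
    (hf : IsLocallyNilpotent (Veronese.jacobian f)) :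
    IsLocallyNilpotent (Veronese.jacobian g) := by
  refine isLocallyNilpotent_of_forall_X _ fun i => ?_
  obtain ⟨n, hn⟩ := hf (X i)
  have key (n : ℕ) : ∃ e', IsLeading a b e' ((Veronese.jacobian f)^[n] (X i))
      ((Veronese.jacobian g)^[n] (X i)) := by
    induction n with
    | zero => exact ⟨_, isLeading_X a b i⟩
    | succ n ih =>
      obtain ⟨e', h'⟩ := ih
      rw [Function.iterate_succ_apply', Function.iterate_succ_apply']
      exact ⟨_, h.jacobian h'⟩
  obtain ⟨e', h'⟩ := key n
  rw [hn] at h'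
  exact ⟨n, h'.eq_zero⟩

end LeadingForm

/-! ### Monomials in two variables. -/

section QuasiHomogeneous

variable {K : Type*} [Field K]

lemma monomial_fin_two (s : Fin 2 →₀ ℕ) (c : K) :
    monomial s c = C c * (X 0 ^ s 0 * X 1 ^ s 1) := by
  rw [monomial_eq, Finsupp.prod_fintype _ _ (by simp), Fin.prod_univ_two]

lemma finsupp_fin_two_ext {s t : Fin 2 →₀ ℕ} (h0 : s 0 = t 0) (h1 : s 1 = t 1) : s = t := by
  ext i
  fin_cases i
  exacts [h0, h1]

lemma X_dvd_of_forall_coeff {f : MvPolynomial (Fin 2) K} {i : Fin 2}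
    (h : ∀ s, coeff s f ≠ 0 → s i ≠ 0) : X i ∣ f := by
  rw [f.as_sum]
  refine Finset.dvd_sum fun s hs => ?_
  rw [X_dvd_monomial]
  exact Or.inr (h s (mem_support_iff.mp hs))

lemma pderiv_ne_zero [CharZero K] {f : MvPolynomial (Fin 2) K} {i : Fin 2} {s : Fin 2 →₀ ℕ}
    (hs : coeff s f ≠ 0) (hi : s i ≠ 0) : pderiv i f ≠ 0 := by
  intro h
  have h1 : s - Finsupp.single i 1 + Finsupp.single i 1 = s := by
    refine tsub_add_cancel_of_le ?_
    rw [Finsupp.single_le_iff]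
    omega
  have h2 := coeff_pderiv (i := i) f (s - Finsupp.single i 1)
  rw [h, h1, coeff_zero] at h2
  refine mul_ne_zero hs ?_ h2.symm
  exact Nat.cast_add_one_ne_zero _

end QuasiHomogeneous

/-! ### Quasi-homogeneous forms with locally nilpotent Jacobian derivation. -/

section QuasiHomogeneousForms

variable {K : Type*} [Field K]

/-- The exponents of a quasi-homogeneous form of weight `a b r`. -/
lemma exists_exponent_eq {a b r : ℕ} (hb : 0 < b) (ha : 0 < a) (hab : a.Coprime b)
    {s : Fin 2 →₀ ℕ} (hs : weight a b s = a * b * r) :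
    ∃ l ≤ r, s 0 = b * l ∧ s 1 = a * (r - l) := by
  have hs' : a * s 0 + b * s 1 = a * b * r := by
    simp only [weight] at hs
    exact_mod_cast hs
  have h1 : b ∣ a * s 0 := by
    rw [← Nat.dvd_add_left (Dvd.intro (s 1) rfl : b ∣ b * s 1), hs']
    exact ⟨a * r, by ring⟩
  obtain ⟨l, hl⟩ := hab.symm.dvd_of_dvd_mul_left h1
  have h2 : a * l + s 1 = a * r := by
    refine Nat.eq_of_mul_eq_mul_left hb ?_
    rw [← mul_assoc b a r, mul_comm b a, ← hs', hl]
    ring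
  have hlr : l ≤ r := Nat.le_of_mul_le_mul_left (by omega : a * l ≤ a * r) ha
  refine ⟨l, hlr, hl, ?_⟩
  rw [Nat.mul_sub]
  omega

/-- Over an algebraically closed field a quasi-homogeneous form that is divisible by neither
variable has a factor `x ^ b - μ y ^ a`. -/
lemma exists_quasiHomogeneous_dvd [IsAlgClosed K] {a b r : ℕ} (ha : 0 < a) (hb : 0 < b)
    (hr : 0 < r) (hab : a.Coprime b) {f : MvPolynomial (Fin 2) K}
    (hf : ∀ s, coeff s f ≠ 0 → weight a b s = a * b * r)
    (hx : coeff (Finsupp.single 0 (b * r)) f ≠ 0) (hy : coeff (Finsupp.single 1 (a * r)) f ≠ 0) :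
    ∃ μ : K, μ ≠ 0 ∧ X 0 ^ b - C μ * X 1 ^ a ∣ f := by
  classical
  -- Dehomogenise: put `y = 1` and take `x^b` as the variable. All exponents are `(b l, a (r - l))`,
  -- so the division is exact.
  let P : Polynomial K := ∑ s ∈ f.support, Polynomial.monomial (s 0 / b) (coeff s f)
  have hP {l : ℕ} {t : Fin 2 →₀ ℕ} (hl : l ≤ r) (h0 : t 0 = b * l) (h1 : t 1 = a * (r - l)) :
      P.coeff l = coeff t f := by
    simp only [P, Polynomial.finsetSum_coeff, Polynomial.coeff_monomial]
    rw [Finset.sum_eq_single t]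
    · rw [h0, Nat.mul_div_cancel_left _ hb, if_pos rfl]
    · intro s hs hst
      refine if_neg fun h => hst ?_
      obtain ⟨l', hl', h0', h1'⟩ := exists_exponent_eq hb ha hab (hf s (mem_support_iff.mp hs))
      rw [h0', Nat.mul_div_cancel_left _ hb] at h
      subst h
      exact finsupp_fin_two_ext (h0'.trans h0.symm) (h1'.trans h1.symm)
    · intro ht
      rw [notMem_support_iff.mp ht, ite_self]
  have hPr : P.coeff r ≠ 0 := by
    rwa [hP le_rfl (t := Finsupp.single 0 (b * r)) (by simp) (by simp)]
  have hP0 : P.coeff 0 ≠ 0 := by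
    rwa [hP (Nat.zero_le r) (t := Finsupp.single 1 (a * r)) (by simp) (by simp)]
  obtain ⟨μ, hμ⟩ := IsAlgClosed.exists_root P fun h => by
    rw [Polynomial.eq_C_of_degree_eq_zero h, Polynomial.coeff_C_of_ne_zero hr.ne'] at hPr
    exact hPr rfl
  refine ⟨μ, ?_, ?_⟩
  · rintro rfl
    rw [Polynomial.IsRoot, ← Polynomial.coeff_zero_eq_eval_zero] at hμ
    exact hP0 hμ
  -- Subtracting `P(μ) y^(a r) = 0` makes each summand a multiple of `(x^b)^l - (μ y^a)^l`.
  · have h : f = ∑ s ∈ f.support, (monomial s (coeff s f) -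
        C (coeff s f * μ ^ (s 0 / b)) * (X 1 ^ a) ^ r) := by
      rw [Finset.sum_sub_distrib, ← f.as_sum, ← Finset.sum_mul, ← map_sum]
      have : ∑ s ∈ f.support, coeff s f * μ ^ (s 0 / b) = P.eval μ := by
        simp [P, Polynomial.eval_finsetSum]
      rw [this, hμ.eq_zero]
      simp
    rw [h]
    refine Finset.dvd_sum fun s hs => ?_
    obtain ⟨l, hl, h0, h1⟩ := exists_exponent_eq hb ha hab (hf s (mem_support_iff.mp hs))
    obtain ⟨k, rfl⟩ := Nat.exists_eq_add_of_le hl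
    rw [h0, Nat.mul_div_cancel_left _ hb, monomial_fin_two, h0, h1, Nat.add_sub_cancel_left]
    have : C (coeff s f) * (X 0 ^ (b * l) * X 1 ^ (a * k)) -
        C (coeff s f * μ ^ l) * (X 1 ^ a) ^ (l + k) =
        C (coeff s f) * (X 1 ^ a) ^ k *
          (((X 0 : MvPolynomial (Fin 2) K) ^ b) ^ l - (C μ * X 1 ^ a) ^ l) := by
      rw [C_mul, C_pow, pow_mul, pow_mul]
      ring
    rw [this]
    exact (sub_dvd_pow_sub_pow _ _ l).mul_left _

lemma exists_coeff_ne_zero_of_degreeOf {f : MvPolynomial (Fin 2) K} {i : Fin 2}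
    (h : 0 < degreeOf i f) : ∃ s, coeff s f ≠ 0 ∧ s i = degreeOf i f := by
  have hne : f.support.Nonempty := by
    rw [Finset.nonempty_iff_ne_empty]
    intro h0
    rw [support_eq_empty.mp h0, degreeOf_zero] at h
    omega
  obtain ⟨s, hs, h⟩ := Finset.exists_mem_eq_sup f.support hne fun s => s i
  exact ⟨s, mem_support_iff.mp hs, by rw [degreeOf_eq_sup, h]⟩

variable [CharZero K]

/-- A quasi-homogeneous form with locally nilpotent Jacobian derivation is a multiple of a power of
`x ^ b - μ y ^ a`, and `a = 1` or `b = 1`. -/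
lemma eq_mul_pow_of_isLocallyNilpotent [IsAlgClosed K] {a b r : ℕ} (ha : 0 < a) (hb : 0 < b)
    (hr : 0 < r) (hab : a.Coprime b) {f : MvPolynomial (Fin 2) K}
    (hf : ∀ s, coeff s f ≠ 0 → weight a b s = a * b * r)
    (hx : coeff (Finsupp.single 0 (b * r)) f ≠ 0) (hy : coeff (Finsupp.single 1 (a * r)) f ≠ 0)
    (hD : IsLocallyNilpotent (jacobian f)) :
    ∃ c μ : K, c ≠ 0 ∧ μ ≠ 0 ∧ f = C c * (X 0 ^ b - C μ * X 1 ^ a) ^ r ∧ (a = 1 ∨ b = 1) := by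
  obtain ⟨μ, hμ, hdvd⟩ := exists_quasiHomogeneous_dvd ha hb hr hab hf hx hy
  have hf0 : f ≠ 0 := by
    rintro rfl
    exact hx (coeff_zero _)
  have hEw : jacobian f (X 0 ^ b - C μ * X 1 ^ a) = 0 :=
    hD.eq_zero_of_dvd hf0 (jacobian_self f) hdvd
  have hE0 : jacobian f (X 0) ≠ 0 := by
    rw [jacobian_X_zero, neg_ne_zero]
    exact pderiv_ne_zero hy (by simp [ha.ne', hr.ne'])
  have hE1 : jacobian f (X 1) ≠ 0 := by
    rw [jacobian_X_one]
    exact pderiv_ne_zero hx (by simp [hb.ne', hr.ne'])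
  set c := coeff (Finsupp.single 0 (b * r)) f with hc
  refine ⟨c, μ, hx, hμ, ?_, ?_⟩
  -- The difference lies in the kernel and, its pure power of `x` having cancelled, is divisible by
  -- `y`. Were it nonzero, `y` would lie in the kernel.
  · by_contra hne
    refine hE1 (hD.eq_zero_of_dvd (sub_ne_zero.mpr hne) ?_ ?_)
    · have hC : jacobian f (C c) = 0 := Derivation.map_algebraMap _ _
      rw [map_sub, jacobian_self, Derivation.leibniz, Derivation.leibniz_pow, hEw, hC]
      simp
    · have : f - C c * (X 0 ^ b - C μ * X 1 ^ a) ^ r = (f - monomial (Finsupp.single 0 (b * r)) c) -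
          C c * ((X 0 ^ b - C μ * X 1 ^ a) ^ r - (X 0 ^ b) ^ r) := by
        rw [monomial_fin_two]
        simp only [Finsupp.single_eq_same, ne_eq, one_ne_zero, not_false_eq_true,
          Finsupp.single_eq_of_ne, pow_zero, mul_one]
        ring
      rw [this]
      refine dvd_sub (X_dvd_of_forall_coeff fun s hs h1 => ?_) (Dvd.dvd.mul_left ?_ _)
      · classical
        rw [coeff_sub, coeff_monomial] at hs
        split_ifs at hs with h
        · rw [← h, ← hc, sub_self] at hs
          exact hs rfl
        · rw [sub_zero] at hs
          obtain ⟨l, hl, h0', h1'⟩ := exists_exponent_eq hb ha hab (hf s hs)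
          rw [h1, eq_comm, mul_eq_zero] at h1'
          obtain rfl : l = r := by omega
          exact h (finsupp_fin_two_ext (by simp [h0']) (by simp [h1]))
      · refine dvd_trans ?_ (sub_dvd_pow_sub_pow _ _ r)
        rw [sub_sub_cancel_left, dvd_neg]
        exact (dvd_pow_self _ ha.ne').mul_left _
  -- Applying `D` to `x^b - μ y^a` gives `b x^(b-1) D x = μ a y^(a-1) D y`. For `a, b ≥ 2` this
  -- yields `y ∣ D x` and `x ∣ D y`.
  · by_contra! hab1
    have hCb : (C (b : K) : MvPolynomial (Fin 2) K) = b := map_natCast C b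
    have hCa : (C (a : K) : MvPolynomial (Fin 2) K) = a := map_natCast C a
    have hC : jacobian f (C μ) = 0 := Derivation.map_algebraMap _ _
    rw [map_sub, Derivation.leibniz, Derivation.leibniz_pow, Derivation.leibniz_pow, hC, smul_zero,
      add_zero, sub_eq_zero] at hEw
    simp only [nsmul_eq_mul, smul_eq_mul] at hEw
    have h01 : ¬ (X 1 : MvPolynomial (Fin 2) K) ∣ X 0 := by
      rw [X_dvd_X]; decide
    have h10 : ¬ (X 0 : MvPolynomial (Fin 2) K) ∣ X 1 := by
      rw [X_dvd_X]; decide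
    have hunit {d : K} (hd : d ≠ 0) (i : Fin 2) : ¬ (X i : MvPolynomial (Fin 2) K) ∣ C d :=
      fun h => X_prime.not_isUnit (isUnit_of_dvd_unit h (hd.isUnit.map C))
    refine hD.not_dvd_and_dvd hE0 hE1 ⟨?_, ?_⟩
    · have h : (X 1 : MvPolynomial (Fin 2) K) ∣
          (b : MvPolynomial (Fin 2) K) * (X 0 ^ (b - 1) * jacobian f (X 0)) := by
        rw [hEw]
        exact (((dvd_pow_self _ (by omega)).mul_right _).mul_left _).mul_left _
      rcases X_prime.dvd_or_dvd h with h | h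
      · rw [← hCb] at h
        exact absurd h (hunit (Nat.cast_ne_zero.mpr hb.ne') 1)
      · rcases X_prime.dvd_or_dvd h with h | h
        · exact absurd (X_prime.dvd_of_dvd_pow h) h01
        · exact h
    · have h : (X 0 : MvPolynomial (Fin 2) K) ∣
          C μ * ((a : MvPolynomial (Fin 2) K) * (X 1 ^ (a - 1) * jacobian f (X 1))) := by
        rw [← hEw]
        exact ((dvd_pow_self _ (by omega)).mul_right _).mul_left _
      rcases X_prime.dvd_or_dvd h with h | h
      · exact absurd h (hunit hμ 0)
      rcases X_prime.dvd_or_dvd h with h | h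
      · rw [← hCa] at h
        exact absurd h (hunit (Nat.cast_ne_zero.mpr ha.ne') 0)
      · rcases X_prime.dvd_or_dvd h with h | h
        · exact absurd (X_prime.dvd_of_dvd_pow h) h10
        · exact h

/-- The leading form of a polynomial with locally nilpotent Jacobian derivation, for the weights
given by its Newton polygon. -/
theorem exists_isLeading_mul_pow [IsAlgClosed K] {q : MvPolynomial (Fin 2) K}
    (hD : IsLocallyNilpotent (jacobian q)) (h0 : 0 < degreeOf 0 q) (h1 : 0 < degreeOf 1 q) :
    ∃ (a b r : ℕ) (c μ : K), 0 < a ∧ 0 < b ∧ 0 < r ∧ c ≠ 0 ∧ μ ≠ 0 ∧ degreeOf 0 q = b * r ∧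
      degreeOf 1 q = a * r ∧ (a = 1 ∨ b = 1) ∧
      IsLeading a b (a * b * r) q (C c * (X 0 ^ b - C μ * X 1 ^ a) ^ r) := by
  -- The weights are the two partial degrees divided by their gcd `r`, crosswise, so that both
  -- extreme pure powers get weight `a b r`.
  obtain ⟨r, a, b, hr, hab, ha', hb'⟩ :=
    Nat.exists_coprime' (Nat.gcd_pos_of_pos_left (degreeOf 0 q) h1)
  have ha : 0 < a := Nat.pos_of_mul_pos_right (ha' ▸ h1)
  have hb : 0 < b := Nat.pos_of_mul_pos_right (hb' ▸ h0)
  have hq0 : q ≠ 0 := by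
    rintro rfl
    simp at h0
  obtain ⟨e, g, hg0, hg⟩ := exists_isLeading a b hq0
  have hDg := hg.isLocallyNilpotent_jacobian hD
  obtain ⟨s, hs, hs0⟩ := exists_coeff_ne_zero_of_degreeOf h0
  obtain ⟨t, ht, ht1⟩ := exists_coeff_ne_zero_of_degreeOf h1
  have hse := hg.weight_le hs
  have hte := hg.weight_le ht
  rw [weight, hs0, hb'] at hse
  rw [weight, ht1, ha'] at hte
  push_cast at hse hte
  -- A larger weight would force both variables into every monomial of `g`. Then `x` divides `g`, so
  -- it lies in the kernel, although `∂g/∂y ≠ 0`.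
  have he : e = a * b * r := by
    refine le_antisymm ?_ (by nlinarith)
    by_contra! hlt
    have hpos (u) (hu : coeff u g ≠ 0) : u 0 ≠ 0 ∧ u 1 ≠ 0 := by
      have hue := hg.1 u hu
      have huq : coeff u q ≠ 0 := by rwa [hg.coeff_eq hue]
      have hu0 := monomial_le_degreeOf 0 (mem_support_iff.mpr huq)
      have hu1 := monomial_le_degreeOf 1 (mem_support_iff.mpr huq)
      rw [hb'] at hu0
      rw [ha'] at hu1
      rw [weight] at hue
      zify at hu0 hu1
      have ha'' : (0 : ℤ) < a := by exact_mod_cast ha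
      have hb'' : (0 : ℤ) < b := by exact_mod_cast hb
      constructor
      · intro h
        rw [h] at hue
        push_cast at hue
        nlinarith [mul_le_mul_of_nonneg_left hu1 hb''.le]
      · intro h
        rw [h] at hue
        push_cast at hue
        nlinarith [mul_le_mul_of_nonneg_left hu0 ha''.le]
    have hX0 := hDg.eq_zero_of_dvd hg0 (jacobian_self g)
      (X_dvd_of_forall_coeff (i := 0) fun u hu => (hpos u hu).1)
    obtain ⟨u, hu⟩ := ne_zero_iff.mp hg0
    rw [jacobian_X_zero, neg_eq_zero] at hX0
    exact pderiv_ne_zero hu (hpos u hu).2 hX0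
  subst he
  have ha'' : (0 : ℤ) < a := by exact_mod_cast ha
  have hb'' : (0 : ℤ) < b := by exact_mod_cast hb
  have hs1 : s 1 = 0 := by
    have : (s 1 : ℤ) ≤ 0 := by nlinarith
    omega
  have ht0 : t 0 = 0 := by
    have : (t 0 : ℤ) ≤ 0 := by nlinarith
    omega
  obtain rfl : s = Finsupp.single 0 (b * r) :=
    finsupp_fin_two_ext (by simp [hs0, hb']) (by simp [hs1])
  obtain rfl : t = Finsupp.single 1 (a * r) :=
    finsupp_fin_two_ext (by simp [ht0]) (by simp [ht1, ha'])
  rw [hg.coeff_eq (by simp [weight]; ring)] at hs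
  rw [hg.coeff_eq (by simp [weight]; ring)] at ht
  obtain ⟨c, μ, hc, hμ, rfl, hor⟩ :=
    eq_mul_pow_of_isLocallyNilpotent ha hb hr hab hg.1 hs ht hDg
  exact ⟨a, b, r, c, μ, ha, hb, hr, hc, hμ, hb', ha', hor, hg⟩

end QuasiHomogeneousForms

/-! ### The grading as an action of roots of unity. -/

section Grading

variable {K : Type*} [Field K]

/-- The endomorphism `(ζ x, ζ y)`. -/
noncomputable def scale (ζ : K) : MvPolynomial (Fin 2) K →ₐ[K] MvPolynomial (Fin 2) K :=
  aeval fun i => C ζ * X i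

lemma scale_X (ζ : K) (i : Fin 2) : scale ζ (X i) = C ζ * X i := aeval_X _ _

lemma scale_monomial (ζ : K) (s : Fin 2 →₀ ℕ) (c : K) :
    scale ζ (monomial s c) = C (ζ ^ (s 0 + s 1)) * monomial s c := by
  rw [monomial_fin_two, map_mul, map_mul, map_pow, map_pow, scale_X, scale_X, ← algebraMap_eq,
    AlgHom.commutes, map_pow]
  ring

lemma coeff_scale (ζ : K) (f : MvPolynomial (Fin 2) K) (s : Fin 2 →₀ ℕ) :
    coeff s (scale ζ f) = ζ ^ (s 0 + s 1) * coeff s f := by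
  classical
  induction f using MvPolynomial.induction_on' with
  | monomial t c =>
    rw [scale_monomial, coeff_C_mul, coeff_monomial]
    split_ifs with h
    · rw [h]
    · simp
  | add p q hp hq => rw [map_add, coeff_add, hp, hq, coeff_add, mul_add]

lemma mem_gradedPart_iff {n : ℕ} {i : ZMod n} {f : MvPolynomial (Fin 2) K} :
    f ∈ gradedPart K n i ↔ ∀ s, coeff s f ≠ 0 → ((s 0 + s 1 : ℕ) : ZMod n) = i := by
  classical
  constructor
  · intro hf
    induction hf using Submodule.span_induction with
    | mem p hp =>
      obtain ⟨u, v, huv, rfl⟩ := hp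
      intro s hs
      have : (X 0 ^ u * X 1 ^ v : MvPolynomial (Fin 2) K) =
          monomial (Finsupp.single 0 u + Finsupp.single 1 v) 1 := by
        simp [monomial_fin_two]
      rw [this, coeff_monomial] at hs
      split_ifs at hs with h
      · rw [← h, ← huv]
        simp
      · exact absurd rfl hs
    | zero => simp
    | add p q _ _ hp hq =>
      intro s hs
      rcases coeff_ne_zero_or_of_coeff_add_ne_zero hs with hs | hs
      exacts [hp s hs, hq s hs]
    | smul c p _ hp =>
      intro s hs
      rw [coeff_smul] at hs
      exact hp s (right_ne_zero_of_mul hs)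
  · intro h
    rw [f.as_sum]
    refine Submodule.sum_mem _ fun s hs => ?_
    rw [monomial_fin_two, ← smul_eq_C_mul]
    exact Submodule.smul_mem _ _
      (Submodule.subset_span ⟨s 0, s 1, h s (mem_support_iff.mp hs), rfl⟩)

lemma X_mem_gradedPart (n : ℕ) (i : Fin 2) : (X i : MvPolynomial (Fin 2) K) ∈ gradedPart K n 1 := by
  refine Submodule.subset_span ?_
  fin_cases i
  · exact ⟨1, 0, by simp, by simp⟩
  · exact ⟨0, 1, by simp, by simp⟩

lemma C_mul_mem_gradedPart {n : ℕ} {i : ZMod n} {f : MvPolynomial (Fin 2) K} (c : K)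
    (hf : f ∈ gradedPart K n i) : C c * f ∈ gradedPart K n i := by
  rw [← smul_eq_C_mul]
  exact Submodule.smul_mem _ _ hf

lemma mem_gradedPart_one_iff_scale {n : ℕ} {ε : K} (hε : IsPrimitiveRoot ε n) (hn : n ≠ 0)
    {f : MvPolynomial (Fin 2) K} : f ∈ gradedPart K n 1 ↔ scale ε f = C ε * f := by
  rw [mem_gradedPart_iff, MvPolynomial.ext_iff]
  refine forall_congr' fun s => ?_
  rw [coeff_scale, coeff_C_mul]
  by_cases hs : coeff s f = 0
  · simp [hs]
  · simp only [hs, ne_eq, not_false_eq_true, true_imp_iff, mul_left_inj' hs]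
    obtain ⟨u, rfl⟩ := hε.isUnit hn
    rw [IsPrimitiveRoot.coe_units_iff] at hε
    generalize s 0 + s 1 = k
    rw [← Nat.cast_one, ZMod.natCast_eq_natCast_iff, hε.eq_orderOf, ← pow_eq_pow_iff_modEq,
      pow_one, ← Units.val_pow_eq_pow_val, Units.val_inj]

/-- For a primitive root of unity `ε`, the `n`-graded automorphisms are those commuting with
`(ε x, ε y)`. -/
lemma isNGraded_iff_commute_scale {n : ℕ} {ε : K} (hε : IsPrimitiveRoot ε n) (hn : n ≠ 0)
    {φ : MvPolynomial (Fin 2) K ≃ₐ[K] MvPolynomial (Fin 2) K} :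
    IsNGraded n φ ↔ ∀ f, φ (scale ε f) = scale ε (φ f) := by
  have hC (i : Fin 2) : φ (scale ε (X i)) = C ε * φ (X i) := by
    rw [scale_X, map_mul, ← algebraMap_eq, AlgEquiv.commutes]
  rw [IsNGraded, mem_gradedPart_one_iff_scale hε hn, mem_gradedPart_one_iff_scale hε hn]
  constructor
  · rintro ⟨h0, h1⟩ f
    have : φ.toAlgHom.comp (scale ε) = (scale ε).comp φ.toAlgHom := by
      refine algHom_ext fun i => ?_
      change φ (scale ε (X i)) = scale ε (φ (X i))
      rw [hC]
      fin_cases i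
      exacts [h0.symm, h1.symm]
    exact DFunLike.congr_fun this f
  · intro h
    exact ⟨by rw [← h, hC], by rw [← h, hC]⟩

end Grading

/-! ### Graded elementary automorphisms. -/

section Tame

variable {K : Type*} [Field K] {n : ℕ}
  {φ ψ : MvPolynomial (Fin 2) K ≃ₐ[K] MvPolynomial (Fin 2) K}

lemma IsNGraded.mul {ε : K} (hε : IsPrimitiveRoot ε n) (hn : n ≠ 0)
    (hφ : IsNGraded n φ) (hψ : IsNGraded n ψ) : IsNGraded n (φ * ψ) := by
  rw [isNGraded_iff_commute_scale hε hn] at *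
  intro f
  rw [AlgEquiv.mul_apply, AlgEquiv.mul_apply, hψ, hφ]

lemma IsTameNGraded.mul (hφ : IsTameNGraded n φ) (hψ : IsTameNGraded n ψ) :
    IsTameNGraded n (φ * ψ) := by
  obtain ⟨l, hl, rfl⟩ := hφ
  obtain ⟨l', hl', rfl⟩ := hψ
  refine ⟨l ++ l', fun χ hχ => ?_, List.prod_append⟩
  rcases List.mem_append.mp hχ with hχ | hχ
  exacts [hl χ hχ, hl' χ hχ]

lemma IsElementary.isTameNGraded (hφ : IsElementary φ) (hφ' : IsNGraded n φ) :
    IsTameNGraded n φ :=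
  ⟨[φ], by simpa using ⟨hφ, hφ'⟩, by simp⟩

lemma aeval_X_map (φ : MvPolynomial (Fin 2) K →ₐ[K] MvPolynomial (Fin 2) K) (i : Fin 2)
    (f : Polynomial K) : φ (Polynomial.aeval (X i) f) = Polynomial.aeval (φ (X i)) f :=
  (Polynomial.aeval_algHom_apply φ (X i) f).symm

/-- The endomorphism `(x, c y + f(x))` for `i = 1` and `(c x + f(y), y)` for `i = 0`. -/
noncomputable def elementaryHom (i : Fin 2) (c : K) (f : Polynomial K) :
    MvPolynomial (Fin 2) K →ₐ[K] MvPolynomial (Fin 2) K :=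
  aeval (Function.update X i (C c * X i + Polynomial.aeval (X (1 - i)) f))

lemma elementaryHom_X_self (i : Fin 2) (c : K) (f : Polynomial K) :
    elementaryHom i c f (X i) = C c * X i + Polynomial.aeval (X (1 - i)) f := by
  simp [elementaryHom]

lemma elementaryHom_X_of_ne {i j : Fin 2} (h : j ≠ i) (c : K) (f : Polynomial K) :
    elementaryHom i c f (X j) = X j := by
  simp [elementaryHom, Function.update_of_ne h]

lemma elementaryHom_comp (i : Fin 2) {c d : K} (hcd : c * d = 1) (f : Polynomial K) :
    (elementaryHom i c f).comp (elementaryHom i d (-(Polynomial.C d * f))) =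
      AlgHom.id K (MvPolynomial (Fin 2) K) := by
  have hi : 1 - i ≠ i := by fin_cases i <;> decide
  refine algHom_ext fun j => ?_
  rw [AlgHom.comp_apply, AlgHom.id_apply]
  by_cases h : j = i
  · subst h
    rw [elementaryHom_X_self, map_add, aeval_X_map, elementaryHom_X_of_ne hi, map_mul,
      elementaryHom_X_self, ← algebraMap_eq, AlgHom.commutes, map_neg, map_mul, Polynomial.aeval_C,
      mul_add, ← mul_assoc, ← map_mul, mul_comm d c, hcd, map_one]
    ring
  · rw [elementaryHom_X_of_ne h, elementaryHom_X_of_ne h]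

/-- The elementary automorphisms. -/
noncomputable def elementaryEquiv (i : Fin 2) {c : K} (hc : c ≠ 0) (f : Polynomial K) :
    MvPolynomial (Fin 2) K ≃ₐ[K] MvPolynomial (Fin 2) K :=
  AlgEquiv.ofAlgHom (elementaryHom i c f) (elementaryHom i c⁻¹ (-(Polynomial.C c⁻¹ * f)))
    (elementaryHom_comp i (mul_inv_cancel₀ hc) f) (by
      have h := elementaryHom_comp i (inv_mul_cancel₀ hc) (-(Polynomial.C c⁻¹ * f))
      rwa [mul_neg, neg_neg, ← mul_assoc, ← Polynomial.C_mul, mul_inv_cancel₀ hc, Polynomial.C_1,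
        one_mul] at h)

lemma elementaryEquiv_X_self (i : Fin 2) {c : K} (hc : c ≠ 0) (f : Polynomial K) :
    elementaryEquiv i hc f (X i) = C c * X i + Polynomial.aeval (X (1 - i)) f :=
  elementaryHom_X_self i c f

lemma elementaryEquiv_X_of_ne {i j : Fin 2} (h : j ≠ i) {c : K} (hc : c ≠ 0) (f : Polynomial K) :
    elementaryEquiv i hc f (X j) = X j :=
  elementaryHom_X_of_ne h c f

lemma isTameNGraded_elementaryEquiv (i : Fin 2) {c : K} (hc : c ≠ 0) {f : Polynomial K}
    (hf : Polynomial.aeval (X (1 - i)) f ∈ gradedPart K n 1) :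
    IsTameNGraded n (elementaryEquiv i hc f) ∧ IsNGraded n (elementaryEquiv i hc f) := by
  have hg : IsNGraded n (elementaryEquiv i hc f) := by
    have key (j : Fin 2) : elementaryEquiv i hc f (X j) ∈ gradedPart K n 1 := by
      by_cases h : j = i
      · subst h
        rw [elementaryEquiv_X_self]
        exact Submodule.add_mem _ (C_mul_mem_gradedPart c (X_mem_gradedPart n j)) hf
      · rw [elementaryEquiv_X_of_ne h]
        exact X_mem_gradedPart n j
    exact ⟨key 0, key 1⟩
  refine ⟨IsElementary.isTameNGraded ?_ hg, hg⟩
  fin_cases i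
  · exact Or.inr ⟨c, f, hc, elementaryEquiv_X_self 0 hc f, elementaryEquiv_X_of_ne (by decide) hc f⟩
  · exact Or.inl ⟨c, f, hc, elementaryEquiv_X_of_ne (by decide) hc f, elementaryEquiv_X_self 1 hc f⟩

lemma algEquiv_ext {φ ψ : MvPolynomial (Fin 2) K ≃ₐ[K] MvPolynomial (Fin 2) K}
    (h0 : φ (X 0) = ψ (X 0)) (h1 : φ (X 1) = ψ (X 1)) : φ = ψ := by
  have : φ.toAlgHom = ψ.toAlgHom := by
    refine algHom_ext fun i => ?_
    fin_cases i
    exacts [h0, h1]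
  exact AlgEquiv.ext fun f => DFunLike.congr_fun this f

lemma elementaryEquiv_inverse (i : Fin 2) (f : Polynomial K) :
    elementaryEquiv i one_ne_zero (-f) * elementaryEquiv i one_ne_zero f = 1 := by
  refine AlgEquiv.ext fun g => ?_
  have h := elementaryHom_comp i (one_mul (1 : K)) (-f)
  rw [Polynomial.C_1, one_mul, neg_neg] at h
  exact DFunLike.congr_fun h g

/-- The automorphism `(y, x)`. -/
noncomputable def swapEquiv (K : Type*) [Field K] :
    MvPolynomial (Fin 2) K ≃ₐ[K] MvPolynomial (Fin 2) K :=
  renameEquiv K (Equiv.swap 0 1)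

lemma swapEquiv_X_zero : swapEquiv K (X 0) = X 1 := by
  simp [swapEquiv]

lemma swapEquiv_X_one : swapEquiv K (X 1) = X 0 := by
  simp [swapEquiv]

lemma swapEquiv_mul_self : swapEquiv K * swapEquiv K = 1 := by
  refine algEquiv_ext ?_ ?_ <;> simp [AlgEquiv.mul_apply, swapEquiv_X_zero, swapEquiv_X_one]

lemma isTameNGraded_swapEquiv : IsTameNGraded n (swapEquiv K) := by
  have hX (c : K) (i : Fin 2) : Polynomial.aeval (X (1 - i) : MvPolynomial (Fin 2) K)
      (Polynomial.C c * Polynomial.X) ∈ gradedPart K n 1 := by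
    rw [map_mul, Polynomial.aeval_C, Polynomial.aeval_X]
    exact C_mul_mem_gradedPart c (X_mem_gradedPart n _)
  have h (i : Fin 2) {c : K} (hc : c ≠ 0) (d : K) :=
    (isTameNGraded_elementaryEquiv i hc (hX d i)).1
  -- The transposition as three shears and a sign change, all linear and hence graded for every `n`.
  have hswap : swapEquiv K =
      elementaryEquiv 1 (neg_ne_zero.mpr one_ne_zero) (Polynomial.C 0 * Polynomial.X) *
      (elementaryEquiv 1 one_ne_zero (Polynomial.C 1 * Polynomial.X) *
      (elementaryEquiv 0 one_ne_zero (Polynomial.C (-1) * Polynomial.X) *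
      elementaryEquiv 1 one_ne_zero (Polynomial.C 1 * Polynomial.X))) := by
    refine algEquiv_ext ?_ ?_ <;>
    simp [AlgEquiv.mul_apply, swapEquiv_X_zero, swapEquiv_X_one, elementaryEquiv_X_self,
      elementaryEquiv_X_of_ne]
  rw [hswap]
  exact (h _ _ _).mul ((h _ _ _).mul ((h _ _ _).mul (h _ _ _)))

lemma isNGraded_swapEquiv : IsNGraded n (swapEquiv K) :=
  ⟨by rw [swapEquiv_X_zero]; exact X_mem_gradedPart n 1,
    by rw [swapEquiv_X_one]; exact X_mem_gradedPart n 0⟩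

lemma degreeOf_swapEquiv (f : MvPolynomial (Fin 2) K) :
    degreeOf 0 (swapEquiv K f) = degreeOf 1 f ∧ degreeOf 1 (swapEquiv K f) = degreeOf 0 f := by
  have h (i : Fin 2) := degreeOf_rename_of_injective (p := f) (Equiv.swap (0 : Fin 2) 1).injective i
  constructor
  · simpa [swapEquiv] using h 1
  · simpa [swapEquiv] using h 0

end Tame

/-! ### Degree reduction and the graded Jung theorem. -/

section Jung

variable {K : Type*} [Field K]

/-- The hypotheses on `σ` say that it preserves weights. They will hold for `y ↦ y + μ⁻¹ x^b` with
weights `(1, b)`. -/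
lemma IsLeading.algHom {a b : ℕ} {e : ℤ} {f g : MvPolynomial (Fin 2) K}
    {σ : MvPolynomial (Fin 2) K →ₐ[K] MvPolynomial (Fin 2) K}
    (h : IsLeading a b e f g) (h0 : IsLeading a b a (σ (X 0)) (σ (X 0)))
    (h1 : IsLeading a b b (σ (X 1)) (σ (X 1))) : IsLeading a b e (σ f) (σ g) := by
  have hmon (s : Fin 2 →₀ ℕ) (c : K) :
      IsLeading a b (weight a b s) (σ (monomial s c)) (σ (monomial s c)) := by
    have := (isLeading_C a b c).mul ((h0.pow (s 0)).mul (h1.pow (s 1)))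
    rw [monomial_fin_two, map_mul, map_mul, map_pow, map_pow, ← algebraMap_eq, AlgHom.commutes,
      algebraMap_eq]
    convert this using 1
    rw [weight]
    ring
  have key (p : MvPolynomial (Fin 2) K) (t) (ht : coeff t (σ p) ≠ 0) :
      ∃ s, coeff s p ≠ 0 ∧ weight a b t = weight a b s := by
    rw [p.as_sum, map_sum, coeff_sum] at ht
    obtain ⟨s, hs, hst⟩ := Finset.exists_ne_zero_of_sum_ne_zero ht
    exact ⟨s, mem_support_iff.mp hs, (hmon s _).1 t hst⟩
  refine ⟨fun t ht => ?_, fun t ht => ?_⟩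
  · obtain ⟨s, hs, hst⟩ := key g t ht
    rw [hst, h.1 s hs]
  · rw [← map_sub] at ht
    obtain ⟨s, hs, hst⟩ := key _ t ht
    rw [hst]
    exact h.2 s hs

variable [CharZero K] {n : ℕ}

lemma exists_aeval_X_zero_eq {f : MvPolynomial (Fin 2) K} (hf : pderiv 1 f = 0) :
    ∃ p : Polynomial K, f = Polynomial.aeval (X 0) p := by
  refine ⟨∑ s ∈ f.support, Polynomial.monomial (s 0) (coeff s f), ?_⟩
  conv_lhs => rw [f.as_sum]
  rw [map_sum]
  refine Finset.sum_congr rfl fun s hs => ?_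
  have hs1 : s 1 = 0 := by
    by_contra h
    exact pderiv_ne_zero (mem_support_iff.mp hs) h hf
  rw [Polynomial.aeval_monomial, monomial_fin_two, hs1, pow_zero, mul_one, algebraMap_eq]

/-- A triangular `n`-graded automorphism is tame. -/
lemma isTameNGraded_of_degreeOf_eq_zero (hn : 2 ≤ n)
    {φ : MvPolynomial (Fin 2) K ≃ₐ[K] MvPolynomial (Fin 2) K} (hφ : IsNGraded n φ)
    (h : degreeOf 1 (φ (X 0)) = 0) : IsTameNGraded n φ := by
  have hq1 : pderiv 1 (φ (X 0)) = 0 := by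
    refine pderiv_eq_zero_of_notMem_vars fun hv => ?_
    rw [mem_vars_iff_mem_support] at hv
    obtain ⟨s, hs, hs1⟩ := hv
    have := monomial_le_degreeOf 1 hs
    rw [h] at this
    exact Finsupp.mem_support_iff.mp hs1 (by omega)
  obtain ⟨j, hj, hjac⟩ := exists_jacobian_eq_C φ
  rw [jacobian_apply, hq1, zero_mul, sub_zero] at hjac
  have hu : IsUnit (pderiv 0 (φ (X 0)) * pderiv 1 (φ (X 1))) := hjac ▸ hj.isUnit.map C
  obtain ⟨d, hd, hqd⟩ := isUnit_iff_eq_C_of_isReduced.mp (isUnit_of_mul_isUnit_left hu)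
  obtain ⟨c, hc, hpc⟩ := isUnit_iff_eq_C_of_isReduced.mp (isUnit_of_mul_isUnit_right hu)
  have hq : φ (X 0) = C d * X 0 := by
    rw [← sub_eq_zero]
    have hmem : φ (X 0) - C d * X 0 ∈ gradedPart K n 1 :=
      Submodule.sub_mem _ hφ.1 (C_mul_mem_gradedPart d (X_mem_gradedPart n 0))
    have h0 : pderiv 0 (φ (X 0) - C d * X 0) = 0 := by simp [hqd]
    have h1 : pderiv 1 (φ (X 0) - C d * X 0) = 0 := by simp [hq1]
    ext s
    rw [coeff_zero]
    by_contra hs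
    have hs' := mem_gradedPart_iff.mp hmem s hs
    have hs0 : s 0 = 0 := by
      by_contra h
      exact pderiv_ne_zero hs h h0
    have hs1 : s 1 = 0 := by
      by_contra h
      exact pderiv_ne_zero hs h h1
    -- Only a constant term could remain, and `0 ≢ 1` modulo `n` since `n ≥ 2`.
    have : Fact (1 < n) := ⟨hn⟩
    simp [hs0, hs1] at hs'
  obtain ⟨f, hf⟩ := exists_aeval_X_zero_eq (f := φ (X 1) - C c * X 1) (by simp [hpc])
  have hfmem : Polynomial.aeval (X (1 - 1)) f ∈ gradedPart K n 1 := by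
    rw [sub_self, ← hf]
    exact Submodule.sub_mem _ hφ.2 (C_mul_mem_gradedPart c (X_mem_gradedPart n 1))
  have hφeq : φ = elementaryEquiv 1 hc.ne_zero f * elementaryEquiv 0 hd.ne_zero 0 := by
    refine algEquiv_ext ?_ ?_
    · rw [AlgEquiv.mul_apply, elementaryEquiv_X_self, map_zero, add_zero, map_mul,
        elementaryEquiv_X_of_ne (by decide), ← algebraMap_eq, AlgEquiv.commutes, hq, algebraMap_eq]
    · rw [AlgEquiv.mul_apply, elementaryEquiv_X_of_ne (by decide), elementaryEquiv_X_self,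
        sub_self, ← hf]
      ring
  rw [hφeq]
  exact (isTameNGraded_elementaryEquiv 1 _ hfmem).1.mul
    (isTameNGraded_elementaryEquiv 0 _ (by rw [map_zero]; exact Submodule.zero_mem _)).1

/-- An elementary automorphism that lowers the degree in `x` of `φ x`. -/
lemma exists_elementaryEquiv_degreeOf_lt [IsAlgClosed K]
    {φ : MvPolynomial (Fin 2) K ≃ₐ[K] MvPolynomial (Fin 2) K} (hφ : IsNGraded n φ)
    (h1 : 0 < degreeOf 1 (φ (X 0))) (h10 : degreeOf 1 (φ (X 0)) ≤ degreeOf 0 (φ (X 0))) :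
    ∃ f : Polynomial K, Polynomial.aeval (X 0 : MvPolynomial (Fin 2) K) f ∈ gradedPart K n 1 ∧
      degreeOf 0 (elementaryEquiv 1 one_ne_zero f (φ (X 0))) < degreeOf 0 (φ (X 0)) ∧
      degreeOf 1 (elementaryEquiv 1 one_ne_zero f (φ (X 0))) ≤ degreeOf 1 (φ (X 0)) := by
  have h0 : 0 < degreeOf 0 (φ (X 0)) := h1.trans_le h10
  obtain ⟨s, hs, hs0⟩ := exists_coeff_ne_zero_of_degreeOf h0
  obtain ⟨t, ht, ht1⟩ := exists_coeff_ne_zero_of_degreeOf h1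
  have hsn := mem_gradedPart_iff.mp hφ.1 s hs
  have htn := mem_gradedPart_iff.mp hφ.1 t ht
  obtain ⟨a, b, r, c, μ, ha, hb, hr, hc, hμ, hq0, hq1, hor, hlead⟩ :=
    exists_isLeading_mul_pow (isLocallyNilpotent_jacobian φ) h0 h1
  obtain rfl : a = 1 := by
    rcases hor with h | h
    · exact h
    · rw [hq0, hq1, h] at h10
      have := Nat.le_of_mul_le_mul_right h10 hr
      omega
  have hb' : (0 : ℤ) < b := by exact_mod_cast hb
  have hse := hlead.weight_le hs
  have hte := hlead.weight_le ht
  rw [hq0] at hs0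
  rw [hq1, one_mul] at ht1
  rw [weight, hs0] at hse
  rw [weight, ht1] at hte
  push_cast at hse hte
  have hs1 : s 1 = 0 := by
    have : (s 1 : ℤ) ≤ 0 := by nlinarith
    omega
  have ht0 : t 0 = 0 := by
    have : (t 0 : ℤ) ≤ 0 := by nlinarith
    omega
  -- The monomials `x^(b r)` and `y^r` of `φ x` have degree `1` modulo `n`, which makes the reducing
  -- substitution graded.
  have hbn : (b : ZMod n) = 1 := by
    rw [ht0, ht1, zero_add] at htn
    rw [hs0, hs1, add_zero, Nat.cast_mul, htn, mul_one] at hsn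
    exact hsn
  refine ⟨Polynomial.C μ⁻¹ * Polynomial.X ^ b, ?_, ?_⟩
  · rw [map_mul, Polynomial.aeval_C, map_pow, Polynomial.aeval_X]
    exact C_mul_mem_gradedPart _ (Submodule.subset_span ⟨b, 0, by simpa using hbn, by simp⟩)
  set σ := elementaryEquiv (1 : Fin 2) (one_ne_zero (α := K))
    (Polynomial.C μ⁻¹ * Polynomial.X ^ b) with hσ
  have hσ0 : σ (X 0) = X 0 := elementaryEquiv_X_of_ne (by decide) _ _
  have hσ1 : σ (X 1) = X 1 + C μ⁻¹ * X 0 ^ b := by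
    rw [hσ, elementaryEquiv_X_self]
    simp [algebraMap_eq]
  have hX0 : IsLeading 1 b (1 : ℕ) (X 0 : MvPolynomial (Fin 2) K) (X 0) := by
    simpa [weight] using isLeading_X 1 b 0
  have hX1 : IsLeading 1 b b (X 1 : MvPolynomial (Fin 2) K) (X 1) := by
    simpa [weight] using isLeading_X 1 b 1
  have hlead' := hlead.algHom (σ := σ.toAlgHom) (by
    change IsLeading 1 b _ (σ (X 0)) (σ (X 0))
    rw [hσ0]
    exact hX0) (by
    change IsLeading 1 b _ (σ (X 1)) (σ (X 1))
    rw [hσ1]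
    refine hX1.add ?_
    convert (isLeading_C 1 b μ⁻¹).mul (hX0.pow b) using 1
    push_cast
    ring)
  change IsLeading 1 b _ (σ (φ (X 0))) (σ _) at hlead'
  have hσg : σ (C c * (X 0 ^ b - C μ * X 1 ^ 1) ^ r) =
      monomial (Finsupp.single 1 r) (c * (-μ) ^ r) := by
    have hC (d : K) : σ (C d) = C d := σ.commutes d
    have hinner : (X 0 ^ b - C μ * (X 1 + C μ⁻¹ * X 0 ^ b) : MvPolynomial (Fin 2) K) =
        C (-μ) * X 1 := by
      have : C μ * (C μ⁻¹ : MvPolynomial (Fin 2) K) = 1 := by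
        rw [← C_mul, mul_inv_cancel₀ hμ, C_1]
      rw [C_neg]
      linear_combination (-(X 0 : MvPolynomial (Fin 2) K) ^ b) * this
    rw [pow_one, map_mul, map_pow, map_sub, map_mul, map_pow, hC, hC, hσ0, hσ1, hinner,
      monomial_fin_two]
    simp only [Finsupp.single_eq_same, ne_eq, zero_ne_one, not_false_eq_true,
      Finsupp.single_eq_of_ne, pow_zero, one_mul, C_mul, C_pow, mul_pow]
    ring
  rw [hσg] at hlead'
  -- The leading form is now a multiple of `y^r`: no other monomial reaches weight `b r`, so `x^(b
  -- r)` is gone.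
  have hsupp (u) (hu : coeff u (σ (φ (X 0))) ≠ 0) : u 0 < b * r ∧ u 1 ≤ r := by
    have hue := hlead'.weight_le hu
    have hue' := hue
    rw [weight] at hue
    push_cast at hue
    constructor
    · by_contra! hlt
      zify at hlt
      have hu1 : u 1 = 0 := by
        have : (u 1 : ℤ) ≤ 0 := by nlinarith
        omega
      have hu0 : (u 0 : ℤ) = b * r := by
        have : (0 : ℤ) ≤ b * u 1 := by positivity
        linarith
      rw [hlead'.coeff_eq (by rw [weight, hu0, hu1]; push_cast; ring)] at hu
      classical
      rw [coeff_monomial] at hu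
      split_ifs at hu with h
      · rw [← h] at hu1
        simp at hu1
        omega
      · exact hu rfl
    · have : (u 1 : ℤ) ≤ r := by nlinarith
      exact_mod_cast this
  constructor
  · rw [hq0, degreeOf_lt_iff (Nat.mul_pos hb hr)]
    exact fun u hu => (hsupp u (mem_support_iff.mp hu)).1
  · rw [hq1, one_mul, degreeOf_le_iff]
    exact fun u hu => (hsupp u (mem_support_iff.mp hu)).2

/-- The graded form of the theorem of Jung and van der Kulk. -/
theorem IsNGraded.isTameNGraded [IsAlgClosed K] (hn : 2 ≤ n)
    {φ : MvPolynomial (Fin 2) K ≃ₐ[K] MvPolynomial (Fin 2) K} (hφ : IsNGraded n φ) :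
    IsTameNGraded n φ := by
  have hn0 : n ≠ 0 := by omega
  have : NeZero (n : K) := ⟨Nat.cast_ne_zero.mpr hn0⟩
  obtain ⟨ε, hε⟩ := HasEnoughRootsOfUnity.exists_primitiveRoot K n
  induction hN : degreeOf 0 (φ (X 0)) + degreeOf 1 (φ (X 0)) using Nat.strong_induction_on
    generalizing φ with
  | _ N ih =>
  have main {ψ : MvPolynomial (Fin 2) K ≃ₐ[K] MvPolynomial (Fin 2) K} (hψ : IsNGraded n ψ)
      (hNψ : degreeOf 0 (ψ (X 0)) + degreeOf 1 (ψ (X 0)) = N)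
      (hle : degreeOf 1 (ψ (X 0)) ≤ degreeOf 0 (ψ (X 0))) : IsTameNGraded n ψ := by
    rcases Nat.eq_zero_or_pos (degreeOf 1 (ψ (X 0))) with h1 | h1
    · exact isTameNGraded_of_degreeOf_eq_zero hn hψ h1
    obtain ⟨f, hf, hlt, hle'⟩ := exists_elementaryEquiv_degreeOf_lt hψ h1 hle
    have hσ := isTameNGraded_elementaryEquiv 1 (one_ne_zero (α := K)) (f := f) hf
    have hσ' := isTameNGraded_elementaryEquiv 1 (one_ne_zero (α := K)) (f := -f) (n := n)
      (by rw [map_neg]; exact Submodule.neg_mem _ hf)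
    have h := ih _ (by rw [AlgEquiv.mul_apply]; omega) (hσ.2.mul hε hn0 hψ) rfl
    have := hσ'.1.mul h
    rwa [← mul_assoc, elementaryEquiv_inverse, one_mul] at this
  -- Swapping the variables keeps the sum of the partial degrees and reduces to `a ≤ b`.
  rcases le_total (degreeOf 1 (φ (X 0))) (degreeOf 0 (φ (X 0))) with hle | hle
  · exact main hφ hN hle
  · have hd := degreeOf_swapEquiv (φ (X 0))
    have h := main (isNGraded_swapEquiv.mul hε hn0 hφ)
      (by rw [AlgEquiv.mul_apply, hd.1, hd.2]; omega)
      (by rw [AlgEquiv.mul_apply, hd.1, hd.2]; exact hle)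
    have := isTameNGraded_swapEquiv.mul h
    rwa [← mul_assoc, swapEquiv_mul_self, one_mul] at this

end Jung

/-! ### Extending automorphisms of the Veronese algebra. -/

section Lifting

variable {K : Type*} [Field K] {n : ℕ}

/-- The generators of the Veronese subalgebra. -/
noncomputable def veroneseGen (K : Type*) [Field K] (n i : ℕ) (hi : i ≤ n) :
    veroneseAlgebra K n :=
  ⟨X 0 ^ (n - i) * X 1 ^ i, Algebra.subset_adjoin ⟨i, hi, rfl⟩⟩

lemma coe_veroneseGen (i : ℕ) (hi : i ≤ n) :
    (veroneseGen K n i hi : MvPolynomial (Fin 2) K) = X 0 ^ (n - i) * X 1 ^ i := rfl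

lemma veroneseAlgebra_induction {P : veroneseAlgebra K n → Prop}
    (hgen : ∀ i hi, P (veroneseGen K n i hi))
    (hC : ∀ c : K, P (algebraMap K _ c)) (hadd : ∀ a b, P a → P b → P (a + b))
    (hmul : ∀ a b, P a → P b → P (a * b)) (a : veroneseAlgebra K n) : P a := by
  obtain ⟨a, ha⟩ := a
  induction ha using Algebra.adjoin_induction with
  | mem p hp =>
    obtain ⟨i, hi, rfl⟩ := hp
    exact hgen i hi
  | algebraMap c => exact hC c
  | add p q _ _ hp hq => exact hadd _ _ hp hq
  | mul p q _ _ hp hq => exact hmul _ _ hp hq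

/-- Nonzero solutions of the equations of the rational normal cone. -/
lemma exists_eq_mul_pow_mul_pow {R : Type*} [CommRing R] [IsDomain R]
    [UniqueFactorizationMonoid R] {n : ℕ} (hn : 0 < n) (u : ℕ → R) (hu0 : u 0 ≠ 0)
    (hu : ∀ i, i < n → u (i + 1) * u 0 = u i * u 1) :
    ∃ g q p : R, ∀ i ≤ n, u i = g * (q ^ (n - i) * p ^ i) := by
  obtain ⟨q, p, d, hqp, hq, hp⟩ :=
    UniqueFactorizationMonoid.exists_reduced_factors (u 0) hu0 (u 1)
  have hd : d ≠ 0 := by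
    rintro rfl
    exact hu0 (by rw [← hq, zero_mul])
  have hq0 : q ≠ 0 := by
    rintro rfl
    exact hu0 (by rw [← hq, mul_zero])
  have hstep (i) (hi : i < n) : u (i + 1) * q = u i * p := by
    refine mul_left_cancel₀ hd ?_
    have := hu i hi
    rw [← hq, ← hp] at this
    linear_combination this
  have hpow (i) (hi : i ≤ n) : u i * q ^ i = u 0 * p ^ i := by
    induction i with
    | zero => simp
    | succ i ih =>
      have h1 := hstep i (by omega)
      have h2 := ih (by omega)
      linear_combination q ^ i * h1 + p * h2
  -- Here `p / q` is `u 1 / u 0` in lowest terms, and `u n * q^n = u 0 * p^n`.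
  have hdvd : q ^ n ∣ u 0 :=
    (hqp.pow : IsRelPrime (q ^ n) (p ^ n)).dvd_of_dvd_mul_right ⟨u n, by
      rw [← hpow n le_rfl, mul_comm]⟩
  obtain ⟨g, hg⟩ := hdvd
  refine ⟨g, q, p, fun i hi => mul_right_cancel₀ (pow_ne_zero i hq0) ?_⟩
  rw [hpow i hi, hg]
  obtain ⟨k, rfl⟩ := Nat.exists_eq_add_of_le hi
  rw [Nat.add_sub_cancel_left, pow_add]
  ring

lemma degreeOf_eq_zero_of_dvd_X_pow_sub_C {n : ℕ} (hn : 0 < n) {g : MvPolynomial (Fin 2) K}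
    {i j : Fin 2} (hij : i ≠ j) {c : K} (h : g ∣ X j ^ n - C c) : degreeOf i g = 0 := by
  have hne : (X j ^ n - C c : MvPolynomial (Fin 2) K) ≠ 0 := by
    classical
    intro h0
    have := congrArg (coeff (Finsupp.single j n)) h0
    rw [coeff_sub, X_pow_eq_monomial, coeff_monomial, if_pos rfl, coeff_C, if_neg, coeff_zero,
      sub_zero] at this
    · exact one_ne_zero this
    · intro h
      have := DFunLike.congr_fun h j
      simp at this
      omega
  obtain ⟨k, hk⟩ := h
  have hdeg := congrArg (degreeOf i) hk
  rw [degreeOf_mul_eq (left_ne_zero_of_mul (hk ▸ hne)) (right_ne_zero_of_mul (hk ▸ hne))] at hdeg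
  have hle : degreeOf i (X j ^ n - C c : MvPolynomial (Fin 2) K) ≤ 0 := by
    refine (degreeOf_sub_le i _ _).trans ?_
    rw [degreeOf_C, max_eq_left (Nat.zero_le _)]
    refine (degreeOf_pow_le i _ n).trans ?_
    rw [degreeOf_X_of_ne hij, mul_zero]
  omega

lemma eq_C_of_degreeOf_eq_zero {g : MvPolynomial (Fin 2) K} (h : ∀ i, degreeOf i g = 0) :
    ∃ c, g = C c := by
  refine ⟨coeff 0 g, ?_⟩
  rw [← totalDegree_eq_zero_iff_eq_C, totalDegree_eq_zero_iff]
  intro s hs i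
  have := monomial_le_degreeOf i hs
  rw [h] at this
  omega

/-- An automorphism of the Veronese subalgebra is the restriction of an endomorphism of
`K[x, y]`. -/
lemma exists_algHom_extending [IsAlgClosed K] (hn : 0 < n)
    (α : veroneseAlgebra K n ≃ₐ[K] veroneseAlgebra K n) :
    ∃ φ : MvPolynomial (Fin 2) K →ₐ[K] MvPolynomial (Fin 2) K,
      ∀ a : veroneseAlgebra K n, φ a = α a := by
  let u (i : ℕ) : MvPolynomial (Fin 2) K :=
    if hi : i ≤ n then (α (veroneseGen K n i hi) : MvPolynomial (Fin 2) K) else 0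
  have hu (i) (hi : i ≤ n) : u i = α (veroneseGen K n i hi) := dif_pos hi
  have hu0 : u 0 ≠ 0 := by
    rw [hu 0 (Nat.zero_le n), Ne, ZeroMemClass.coe_eq_zero, EmbeddingLike.map_eq_zero_iff,
      ← ZeroMemClass.coe_eq_zero]
    simp [coe_veroneseGen, X_ne_zero]
  obtain ⟨g, q, p, hgqp⟩ := exists_eq_mul_pow_mul_pow hn u hu0 fun i hi => by
    rw [hu (i + 1) hi, hu 0 (Nat.zero_le n), hu i hi.le, hu 1 hn]
    simp only [← MulMemClass.coe_mul, ← map_mul]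
    congr 2
    refine Subtype.ext ?_
    simp only [MulMemClass.coe_mul, coe_veroneseGen]
    obtain ⟨k, rfl⟩ : ∃ k, n = i + k + 1 := ⟨n - i - 1, by omega⟩
    rw [show i + k + 1 - (i + 1) = k by omega, show i + k + 1 - i = k + 1 by omega,
      show i + k + 1 - 1 = i + k by omega]
    simp only [Nat.sub_zero]
    ring
  have hconst (a : veroneseAlgebra K n) :
      ∃ c : K, g ∣ (α a : MvPolynomial (Fin 2) K) - C c := by
    induction a using veroneseAlgebra_induction with
    | hgen i hi => exact ⟨0, by rw [← hu i hi, hgqp i hi, C_0, sub_zero]; exact dvd_mul_right _ _⟩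
    | hC c => exact ⟨c, by rw [AlgEquiv.commutes]; exact (sub_self (C c)).symm ▸ dvd_zero g⟩
    | hadd a b ha hb =>
      obtain ⟨c, hc⟩ := ha
      obtain ⟨d, hd⟩ := hb
      refine ⟨c + d, ?_⟩
      rw [map_add, C_add, Subalgebra.coe_add, add_sub_add_comm]
      exact dvd_add hc hd
    | hmul a b ha hb =>
      obtain ⟨c, hc⟩ := ha
      obtain ⟨d, hd⟩ := hb
      refine ⟨c * d, ?_⟩
      rw [map_mul, C_mul, Subalgebra.coe_mul]
      exact dvd_mul_sub_mul hc hd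
  -- By surjectivity `g` divides some `y^n - c` and some `x^n - c'`, so it involves neither
  -- variable.
  have hdeg (i : Fin 2) : degreeOf i g = 0 := by
    fin_cases i
    · obtain ⟨c, hc⟩ := hconst (α.symm (veroneseGen K n n le_rfl))
      rw [AlgEquiv.apply_symm_apply] at hc
      refine degreeOf_eq_zero_of_dvd_X_pow_sub_C hn (j := 1) (by decide) (c := c) ?_
      simpa [coe_veroneseGen] using hc
    · obtain ⟨c, hc⟩ := hconst (α.symm (veroneseGen K n 0 (Nat.zero_le n)))
      rw [AlgEquiv.apply_symm_apply] at hc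
      refine degreeOf_eq_zero_of_dvd_X_pow_sub_C hn (j := 0) (by decide) (c := c) ?_
      simpa [coe_veroneseGen] using hc
  obtain ⟨γ, rfl⟩ := eq_C_of_degreeOf_eq_zero hdeg
  obtain ⟨δ, rfl⟩ := IsAlgClosed.exists_pow_nat_eq γ hn
  refine ⟨aeval ![C δ * q, C δ * p], fun a => ?_⟩
  induction a using veroneseAlgebra_induction with
  | hgen i hi =>
    rw [← hu i hi, hgqp i hi]
    simp only [coe_veroneseGen, map_mul, map_pow, aeval_X, Matrix.cons_val_zero, Matrix.cons_val_one]
    obtain ⟨k, rfl⟩ := Nat.exists_eq_add_of_le hi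
    rw [Nat.add_sub_cancel_left]
    ring
  | hC c => rw [AlgEquiv.commutes]; exact AlgHom.commutes _ c
  | hadd a b ha hb => simp only [map_add, Subalgebra.coe_add, ha, hb]
  | hmul a b ha hb => simp only [map_mul, Subalgebra.coe_mul, ha, hb]

/-- An endomorphism of `K[x, y]` that fixes the Veronese subalgebra is a homothety. -/
lemma exists_eq_scale (hn : 0 < n) {θ : MvPolynomial (Fin 2) K →ₐ[K] MvPolynomial (Fin 2) K}
    (hθ : ∀ a : veroneseAlgebra K n, θ a = a) : ∃ ζ : K, ζ ≠ 0 ∧ θ = scale ζ := by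
  have h0 := hθ (veroneseGen K n 0 (Nat.zero_le n))
  have h1 := hθ (veroneseGen K n 1 hn)
  simp only [coe_veroneseGen, Nat.sub_zero, pow_zero, mul_one, pow_one, map_pow, map_mul] at h0 h1
  obtain ⟨h, hh⟩ : (X 0 : MvPolynomial (Fin 2) K) ∣ θ (X 0) :=
    X_prime.dvd_of_dvd_pow (h0.symm ▸ dvd_pow_self _ hn.ne')
  have hX (i : Fin 2) : (X i : MvPolynomial (Fin 2) K) ≠ 0 := X_ne_zero i
  have hhn : h ^ n = 1 := by
    rw [hh, mul_pow] at h0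
    exact mul_left_cancel₀ (pow_ne_zero n (hX 0)) (by rw [h0, mul_one])
  obtain ⟨ζ, hζ, rfl⟩ := isUnit_iff_eq_C_of_isReduced.mp (IsUnit.of_pow_eq_one hhn hn.ne')
  refine ⟨ζ, hζ.ne_zero, algHom_ext fun i => ?_⟩
  rw [scale_X]
  fin_cases i
  · exact hh.trans (mul_comm _ _)
  -- Invariance of `x^(n-1) y` forces the scalar found for `x` on `y` as well.
  · have h2 : C ζ ^ (n - 1) * θ (X 1) = X 1 := by
      rw [hh, mul_pow, mul_assoc] at h1
      exact mul_left_cancel₀ (pow_ne_zero (n - 1) (hX 0)) h1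
    have h3 : C ζ ^ (n - 1) * C ζ = (1 : MvPolynomial (Fin 2) K) := by
      rw [← pow_succ, Nat.sub_add_cancel hn, hhn]
    change θ (X 1) = C ζ * X 1
    linear_combination C ζ * h2 - θ (X 1) * h3

lemma scale_comp_scale {ζ ξ : K} (h : ζ * ξ = 1) (f : MvPolynomial (Fin 2) K) :
    scale ζ (scale ξ f) = f := by
  ext s
  rw [coeff_scale, coeff_scale, ← mul_assoc, ← mul_pow, h, one_pow, one_mul]

lemma scale_eq_self_of_mem {ε : K} (hε : ε ^ n = 1) (a : veroneseAlgebra K n) :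
    scale ε (a : MvPolynomial (Fin 2) K) = a := by
  induction a using veroneseAlgebra_induction with
  | hgen i hi =>
    have : C ε ^ (n - i) * C ε ^ i = (1 : MvPolynomial (Fin 2) K) := by
      rw [← pow_add, Nat.sub_add_cancel hi, ← C_pow, hε, C_1]
    simp only [coe_veroneseGen, map_mul, map_pow, scale_X]
    linear_combination (X 0 ^ (n - i) * X 1 ^ i) * this
  | hC c => exact AlgHom.commutes _ c
  | hadd a b ha hb => simp only [map_add, Subalgebra.coe_add, ha, hb]
  | hmul a b ha hb => simp only [map_mul, Subalgebra.coe_mul, ha, hb]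

/-- An automorphism of the Veronese subalgebra is the restriction of an automorphism of
`K[x, y]`. -/
lemma exists_algEquiv_extending [IsAlgClosed K] (hn : 0 < n)
    (α : veroneseAlgebra K n ≃ₐ[K] veroneseAlgebra K n) :
    ∃ φ : MvPolynomial (Fin 2) K ≃ₐ[K] MvPolynomial (Fin 2) K,
      ∀ a : veroneseAlgebra K n, φ a = α a := by
  obtain ⟨φ, hφ⟩ := exists_algHom_extending hn α
  obtain ⟨ψ, hψ⟩ := exists_algHom_extending hn α.symm
  obtain ⟨ζ, hζ, h1⟩ := exists_eq_scale hn (θ := ψ.comp φ) fun a => by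
    rw [AlgHom.comp_apply, hφ, hψ, AlgEquiv.symm_apply_apply]
  obtain ⟨ξ, hξ, h2⟩ := exists_eq_scale hn (θ := φ.comp ψ) fun a => by
    rw [AlgHom.comp_apply, hψ, hφ, AlgEquiv.apply_symm_apply]
  have hbij : Function.Bijective φ := by
    constructor
    · intro f g hfg
      have : scale ζ f = scale ζ g := by
        rw [← h1, AlgHom.comp_apply, AlgHom.comp_apply, hfg]
      rw [← scale_comp_scale (inv_mul_cancel₀ hζ) f, this, scale_comp_scale (inv_mul_cancel₀ hζ)]
    · intro g
      refine ⟨ψ (scale ξ⁻¹ g), ?_⟩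
      rw [← AlgHom.comp_apply, h2, scale_comp_scale (mul_inv_cancel₀ hξ)]
  exact ⟨AlgEquiv.ofBijective φ hbij, hφ⟩

lemma constantCoeff_pderiv_scale (ζ : K) (i : Fin 2) (f : MvPolynomial (Fin 2) K) :
    coeff 0 (pderiv i (scale ζ f)) = ζ * coeff 0 (pderiv i f) := by
  rw [coeff_pderiv, coeff_pderiv, coeff_scale]
  fin_cases i <;> simp

/-- An automorphism of `K[x, y]` that preserves the Veronese subalgebra is `n`-graded. -/
lemma isNGraded_of_extends {ε : K} (hε : IsPrimitiveRoot ε n) (hn : 0 < n)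
    (α : veroneseAlgebra K n ≃ₐ[K] veroneseAlgebra K n)
    {φ : MvPolynomial (Fin 2) K ≃ₐ[K] MvPolynomial (Fin 2) K}
    (hφ : ∀ a : veroneseAlgebra K n, φ a = α a) : IsNGraded n φ := by
  have hsymm (a : veroneseAlgebra K n) : φ.symm a = α.symm a := by
    rw [AlgEquiv.symm_apply_eq, hφ, AlgEquiv.apply_symm_apply]
  obtain ⟨ζ, hζ, h⟩ := exists_eq_scale hn
    (θ := (φ.toAlgHom.comp (scale ε)).comp φ.symm.toAlgHom) fun a => by
      change φ (scale ε (φ.symm a)) = a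
      rw [hsymm, scale_eq_self_of_mem hε.pow_eq_one, hφ, AlgEquiv.apply_symm_apply]
  have hcomm (f) : φ (scale ε f) = scale ζ (φ f) := by
    rw [← h]
    change _ = φ (scale ε (φ.symm (φ f)))
    rw [AlgEquiv.symm_apply_apply]
  have hX (i : Fin 2) : scale ζ (φ (X i)) = C ε * φ (X i) := by
    rw [← hcomm, scale_X, map_mul, ← algebraMap_eq, AlgEquiv.commutes]
  -- If `ζ ≠ ε`, the linear parts of `φ x` and `φ y` vanish, and so does the Jacobian at the origin.
  have hζε : ζ = ε := by
    by_contra hne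
    have hlin (i j : Fin 2) : coeff 0 (pderiv i (φ (X j))) = 0 := by
      have := constantCoeff_pderiv_scale ζ i (φ (X j))
      rw [hX, pderiv_C_mul, coeff_C_mul] at this
      rcases mul_eq_mul_right_iff.mp this with h | h
      exacts [absurd h.symm hne, h]
    obtain ⟨c, hc, hjac⟩ := exists_jacobian_eq_C φ
    have := congrArg constantCoeff hjac
    rw [jacobian_apply, constantCoeff_C, map_sub, map_mul, map_mul] at this
    simp only [constantCoeff_eq, hlin, mul_zero, sub_zero] at this
    exact hc this.symm
  rw [isNGraded_iff_commute_scale hε hn.ne']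
  rwa [hζε] at hcomm

end Lifting

end Veronese

theorem theorem1 {K : Type*} [Field K] [IsAlgClosed K] [CharZero K] (n : ℕ) (hn : 2 ≤ n)
    (α : Veronese.veroneseAlgebra K n ≃ₐ[K] Veronese.veroneseAlgebra K n) :
    ∃ φ : MvPolynomial (Fin 2) K ≃ₐ[K] MvPolynomial (Fin 2) K,
      Veronese.IsNGraded n φ ∧ Veronese.IsTameNGraded n φ ∧
      ∀ a : Veronese.veroneseAlgebra K n,
        φ (a : MvPolynomial (Fin 2) K) = (α a : MvPolynomial (Fin 2) K) := by
  have hn0 : 0 < n := by omega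
  have : NeZero (n : K) := ⟨Nat.cast_ne_zero.mpr hn0.ne'⟩
  obtain ⟨ε, hε⟩ := HasEnoughRootsOfUnity.exists_primitiveRoot K n
  obtain ⟨φ, hφ⟩ := Veronese.exists_algEquiv_extending hn0 α
  have hgr := Veronese.isNGraded_of_extends hε hn0 α hφ
  exact ⟨φ, hgr, hgr.isTameNGraded hn, hφ⟩
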